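/- Let $G$ be one of the classical groups $SL(n,\mathbb{C})$, $SO(n,\mathbb{C})$ ($n$ even or odd), or $Sp(N,\mathbb{C})$ with $n=2N$, in its standard realization by complex $n\times n$ matrices, $n\ge 1$. Let $\mathbb{V},\mathbb{W}$ be finite dimensional complex rational $G$-modules endowed with Hermitian norms, and let $v\in\mathbb{V}$, $w\in\mathbb{W}$ be nonzero. *Definitions.* Let $\overline{\mathcal{O}}_{vw}$ and $\overline{\mathcal{O}}_{v}$ be the Zariski closures in $\mathbb{P}(\mathbb{V}\oplus\mathbb{W})$ of the orbits $G\cdot[(v,w)]$ and $G\cdot[(v,0)]$. The pair $(v,w)$ is *semistable* if $\overline{\mathcal{O}}_{vw}\cap\overline{\mathcal{O}}_{v}=\emptyset$. For a maximal algebraic torus $T\subset G$ with character lattice $M_{\mathbb{Z}}$, the weight polytope $\mathcal{N}(e)\subset M_{\mathbb{Z}}\otimes\mathbb{R}$ of a vector $e$ of a rational $G$-module is the convex hull of the characters $a$ for which the component of $e$ in the $a$-weight space is nonzero. Let $\mathbb{I}$ be the identity matrix in the space $\mathcal{GL}(n,\mathbb{C})$ of all $n\times n$ matrices, on which $G$ acts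 by left multiplication. The degree $\deg(\mathbb{V})$ is the least positive integer $k$ such that $\mathcal{N}(e)\subseteq k\,\mathcal{N}(\mathbb{I})$ for all $0\ne e\in\mathbb{V}$ (with respect to any maximal torus $T$; it does not depend on $T$). Put $q=\deg(\mathbb{V})$. The pair $(v,w)$ is *stable* if there is a positive integer $m$ such that the pair $(\mathbb{I}^{\otimes q}\otimes v^{\otimes m},\,w^{\otimes(m+1)})$ is semistable. With $\|\sigma\|^2=\mathrm{Trace}(\sigma\sigma^*)$, define for $\sigma\in G$ $$\nu_{(v,w)}(\sigma)=\log\frac{\|\sigma\cdot w\|^2}{\|w\|^2}-\log\frac{\|\sigma\cdot v\|^2}{\|v\|^2},\qquad J_v(\sigma)=\deg(\mathbb{V})\log\frac{\|\sigma\|^2}{n}-\log\frac{\|\sigma\cdot v\|^2}{\|v\|^2}.$$ The energy $\nu_{(v,w)}$ is *proper* if there are constants $\varepsilon>0$ and $b\in\mathbb{R}$ with $\nu_{(v,w)}(\sigma)\ge\varepsilon J_v(\sigma)+b$ for all $\sigma\in G$. *Proposition.* 1. The pair $(v,w)$ is semistable if and only if $\nu_{(v,w)}$ is bounded below on $G$.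 2. The pair $(v,w)$ is stable if and only if $\nu_{(v,w)}$ is proper. 3. Moreover $$\inf_{\sigma\in G}\nu_{(v,w)}(\sigma)=\log\tan^2\mathrm{dist}\big(\overline{\mathcal{O}}_{vw},\overline{\mathcal{O}}_{v}\big)+\log\frac{\|v\|^2}{\|w\|^2},$$ in $[-\infty,\infty)$ with $\log 0=-\infty$, where $\mathrm{dist}$ is the Fubini–Study distance on $\mathbb{P}(\mathbb{V}\oplus\mathbb{W})$ (the angle in $[0,\pi/2]$ between complex lines) for the orthogonal direct sum of the two norms. In particular the last term vanishes when $\|v\|=\|w\|$. -/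

import Mathlib

open scoped TensorProduct Pointwise LinearAlgebra.Projectivization

noncomputable section

namespace StablePairs

/-! ### Classical groups, regular functions, rational modules -/

/-- `G ⊆ SL(n, ℂ)` is one of `SL(n, ℂ)`, `SO(n, ℂ)` (for the form `∑ xᵢ²`; `n` even or odd) or, when
`n = 2 N`, `Sp(N, ℂ)` (for the standard symplectic form, after identifying the index sets). -/
inductive IsClassicalGroup {n : ℕ} (G : Subgroup (Matrix.SpecialLinearGroup (Fin n) ℂ)) : Prop
  | specialLinear (h : ∀ A, A ∈ G) : IsClassicalGroup G
  | specialOrthogonal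
      (h : ∀ A : Matrix.SpecialLinearGroup (Fin n) ℂ,
        A ∈ G ↔ (A : Matrix (Fin n) (Fin n) ℂ).transpose * (A : Matrix (Fin n) (Fin n) ℂ) = 1) :
      IsClassicalGroup G
  | symplectic (N : ℕ) (e : Fin n ≃ Fin N ⊕ Fin N)
      (h : ∀ A : Matrix.SpecialLinearGroup (Fin n) ℂ,
        A ∈ G ↔ Matrix.reindex e e (A : Matrix (Fin n) (Fin n) ℂ) ∈
          Matrix.symplecticGroup (Fin N) ℂ) :
      IsClassicalGroup G

variable {n : ℕ} {G : Subgroup (Matrix.SpecialLinearGroup (Fin n) ℂ)}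

/-- The underlying matrix of an element of `G`. -/
def toMat (g : G) : Matrix (Fin n) (Fin n) ℂ :=
  ((g : Matrix.SpecialLinearGroup (Fin n) ℂ) : Matrix (Fin n) (Fin n) ℂ)

/-- Regular functions on a subgroup `T` of `G`: restrictions of polynomials in the matrix entries
(no inverse of the determinant is needed, since `det = 1`). -/
def IsRegular (T : Subgroup G) (f : T → ℂ) : Prop :=
  ∃ P : MvPolynomial (Fin n × Fin n) ℂ,
    ∀ t : T, f t = MvPolynomial.eval (fun ij => toMat (t : G) ij.1 ij.2) P

/-- A rational `G`-module: all matrix coefficients are regular functions on `G`. -/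
def IsRational {V : Type*} [AddCommGroup V] [Module ℂ V] (ρ : Representation ℂ G V) : Prop :=
  ∀ (l : Module.Dual ℂ V) (x : V), IsRegular (⊤ : Subgroup G) (fun g => l (ρ (g : G) x))

/-! ### Zariski closures of projective orbits, semistable pairs -/

section Semistable

variable {V W : Type*} [AddCommGroup V] [Module ℂ V] [AddCommGroup W] [Module ℂ W]

/-- The value at `x` of a polynomial in linear functionals; as `P` varies, these are exactly
the polynomial functions on `V`. -/
def polyEval (P : MvPolynomial (Module.Dual ℂ V) ℂ) (x : V) : ℂ :=
  MvPolynomial.eval (fun l => l x) P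

/-- The Zariski closure of `S ⊆ ℙ(V)`: the common zeros of all homogeneous polynomials on `V` that
vanish on `S`. -/
def zariskiClosure (S : Set (ℙ ℂ V)) : Set (ℙ ℂ V) :=
  {p | ∀ (d : ℕ) (P : MvPolynomial (Module.Dual ℂ V) ℂ), P.IsHomogeneous d →
    (∀ s ∈ S, polyEval P s.rep = 0) → polyEval P p.rep = 0}

/-- The projective orbit `G · [x] ⊆ ℙ(V)` of a nonzero vector `x`. -/
def projOrbit {H : Type*} [Group H] (ρ : Representation ℂ H V) (x : V) : Set (ℙ ℂ V) :=
  {p | ∃ (g : H) (h : ρ g x ≠ 0), p = Projectivization.mk ℂ (ρ g x) h}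

/-- The pair `(v, w)` is semistable: in `ℙ(V ⊕ W)` the Zariski closures of the orbits of `[(v, w)]`
and of `[(v, 0)]` are disjoint. -/
def Semistable {H : Type*} [Group H] (ρ : Representation ℂ H V) (σ : Representation ℂ H W)
    (v : V) (w : W) : Prop :=
  Disjoint (zariskiClosure (projOrbit (ρ.prod σ) (v, w)))
    (zariskiClosure (projOrbit (ρ.prod σ) (v, (0 : W))))

end Semistable

/-! ### Maximal tori, weight polytopes, the degree of a module -/

/-- `T` is an algebraic torus in `G`: the image of an injective homomorphism `(ℂˣ)ʳ → G` whose
matrix entries are Laurent polynomials. -/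
def IsTorus (T : Subgroup G) : Prop :=
  ∃ (r : ℕ) (φ : (Fin r → ℂˣ) →* G), Function.Injective φ ∧ φ.range = T ∧
    ∀ i j : Fin n, ∃ P : MvPolynomial (Fin r ⊕ Fin r) ℂ, ∀ t : Fin r → ℂˣ,
      toMat (φ t) i j =
        MvPolynomial.eval (Sum.elim (fun k => (t k : ℂ)) (fun k => ((t k)⁻¹ : ℂ))) P

/-- `T` is a maximal algebraic torus of `G`. -/
def IsMaximalTorus (T : Subgroup G) : Prop := Maximal IsTorus T

theorem isRegular_mul (T : Subgroup G) {f₁ f₂ : T → ℂ} (h₁ : IsRegular T f₁)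
    (h₂ : IsRegular T f₂) : IsRegular T (fun t => f₁ t * f₂ t) := by
  obtain ⟨P, hP⟩ := h₁
  obtain ⟨Q, hQ⟩ := h₂
  exact ⟨P * Q, fun t => (congrArg₂ (· * ·) (hP t) (hQ t)).trans (map_mul _ P Q).symm⟩

/-- The character group of `T`: the homomorphisms of algebraic groups `T → ℂˣ`, i.e. the
homomorphisms `χ` such that `χ` and `χ⁻¹` are regular functions. -/
def characterGroup (T : Subgroup G) : Subgroup (T →* ℂˣ) where
  carrier := {χ | IsRegular T (fun t => (χ t : ℂ)) ∧ IsRegular T (fun t => ((χ⁻¹) t : ℂ))}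
  one_mem' := ⟨⟨1, fun t => by simp⟩, ⟨1, fun t => by simp⟩⟩
  mul_mem' := by
    intro a b ha hb
    refine ⟨?_, ?_⟩
    · simpa using isRegular_mul T ha.1 hb.1
    · have h := isRegular_mul T ha.2 hb.2
      simpa [mul_comm] using h
  inv_mem' := by
    intro a ha
    refine ⟨ha.2, ?_⟩
    simpa using ha.1

/-- The character lattice `M_ℤ` of `T`, written additively. -/
abbrev CharLattice (T : Subgroup G) : Type := Additive (characterGroup T)

/-- The real vector space `M_ℝ = M_ℤ ⊗ ℝ`. -/
abbrev CharSpace (T : Subgroup G) : Type := ℝ ⊗[ℤ] CharLattice T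

/-- The value of a character at an element of `T`. -/
def charEval {T : Subgroup G} (a : CharLattice T) (t : T) : ℂ :=
  ((((Additive.toMul a : characterGroup T) : T →* ℂˣ) t : ℂˣ) : ℂ)

section Weights

variable {V : Type*} [AddCommGroup V] [Module ℂ V]

/-- `e` lies in the weight space `V_a` of `T`. -/
def IsWeightVector (ρ : Representation ℂ G V) (T : Subgroup G) (a : CharLattice T) (e : V) : Prop :=
  ∀ t : T, ρ (t : G) e = charEval a t • e

/-- The support `𝒜(e)`: the characters `a` for which the `V_a`-component of `e` in the decomposition
of `e` into weight vectors is nonzero. -/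
def weightSupport (ρ : Representation ℂ G V) (T : Subgroup G) (e : V) : Set (CharLattice T) :=
  {a | ∃ f : CharLattice T →₀ V, (∀ b, IsWeightVector ρ T b (f b)) ∧
    (f.sum fun _ x => x) = e ∧ f a ≠ 0}

/-- The weight polytope `𝒩(e) = conv 𝒜(e) ⊆ M_ℝ`. -/
def weightPolytope (ρ : Representation ℂ G V) (T : Subgroup G) (e : V) : Set (CharSpace T) :=
  convexHull ℝ ((fun a : CharLattice T => (1 : ℝ) ⊗ₜ[ℤ] a) '' weightSupport ρ T e)

end Weights

/-- The left regular representation of `G` on the space of `n × n` matrices, `(g, A) ↦ g A`. -/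
def leftRegular (G : Subgroup (Matrix.SpecialLinearGroup (Fin n) ℂ)) :
    Representation ℂ G (Matrix (Fin n) (Fin n) ℂ) where
  toFun g := LinearMap.mulLeft ℂ (toMat g)
  map_one' := by
    ext1 A
    simp [toMat]
  map_mul' g h := by
    ext1 A
    simp [toMat]

/-- The degree of a `G`-module `V`: the least positive integer `k` with `𝒩(v) ⊆ k 𝒩(𝕀)` for all
nonzero `v ∈ V`, where weight polytopes are taken with respect to any maximal torus `T` (all maximal
tori being conjugate, each of them gives the same `k`). -/
def degree {V : Type*} [AddCommGroup V] [Module ℂ V] (ρ : Representation ℂ G V) : ℕ :=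
  sInf {k : ℕ | 0 < k ∧ ∀ T : Subgroup G, IsMaximalTorus T → ∀ v : V, v ≠ 0 →
    weightPolytope ρ T v ⊆
      (k : ℝ) • weightPolytope (leftRegular G) T (1 : Matrix (Fin n) (Fin n) ℂ)}

/-! ### Tensor powers, stable pairs -/

/-- The `m`-th tensor power of a representation. -/
def tensorPow {H V : Type*} [Group H] [AddCommGroup V] [Module ℂ V] (ρ : Representation ℂ H V)
    (m : ℕ) : Representation ℂ H (⨂[ℂ]^m V) :=
  (PiTensorProduct.mapMonoidHom (R := ℂ) (s := fun _ : Fin m => V)).comp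
    (MonoidHom.pi fun _ : Fin m => ρ)

/-- The `m`-th tensor power `v ⊗ ⋯ ⊗ v` of a vector. -/
def vecPow {V : Type*} [AddCommGroup V] [Module ℂ V] (v : V) (m : ℕ) : ⨂[ℂ]^m V :=
  PiTensorProduct.tprod ℂ fun _ : Fin m => v

/-- The pair `(v, w)` is stable: for some positive integer `m` the pair `(𝕀^q ⊗ v^m, w^(m+1))` is
semistable, where `q = deg V`. -/
def Stable {V W : Type*} [AddCommGroup V] [Module ℂ V] [AddCommGroup W] [Module ℂ W]
    (ρ : Representation ℂ G V) (σ : Representation ℂ G W) (v : V) (w : W) : Prop :=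
  ∃ m : ℕ, 0 < m ∧
    Semistable ((tensorPow (leftRegular G) (degree ρ)).tprod (tensorPow ρ m)) (tensorPow σ (m + 1))
      (vecPow (1 : Matrix (Fin n) (Fin n) ℂ) (degree ρ) ⊗ₜ[ℂ] vecPow v m) (vecPow w (m + 1))

/-! ### Energies and the Fubini–Study distance -/

section Energy

variable {V W : Type*} [NormedAddCommGroup V] [InnerProductSpace ℂ V]
  [NormedAddCommGroup W] [InnerProductSpace ℂ W]

/-- The finite dimensional Mabuchi energy `ν_{(v,w)}`. -/
def mabuchi {H : Type*} [Group H] (ρ : Representation ℂ H V) (σ : Representation ℂ H W) (v : V)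
    (w : W) (g : H) : ℝ :=
  Real.log (‖σ g w‖ ^ 2 / ‖w‖ ^ 2) - Real.log (‖ρ g v‖ ^ 2 / ‖v‖ ^ 2)

/-- `‖g‖² = Trace(g g*) = ∑ |g_ij|²`. -/
def matNormSq (g : G) : ℝ := ∑ i, ∑ j, ‖toMat g i j‖ ^ 2

/-- The Aubin functional `J_v` (here `n`, the size of the matrices in `G`, is `N + 1`). -/
def aubin (ρ : Representation ℂ G V) (v : V) (g : G) : ℝ :=
  (degree ρ : ℝ) * Real.log (matNormSq g / n) - Real.log (‖ρ g v‖ ^ 2 / ‖v‖ ^ 2)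

/-- The Mabuchi energy of `(v, w)` is proper (relative to `J_v`). -/
def MabuchiProper (ρ : Representation ℂ G V) (σ : Representation ℂ G W) (v : V) (w : W) : Prop :=
  ∃ ε b : ℝ, 0 < ε ∧ ∀ g : G, mabuchi ρ σ v w g ≥ ε * aubin ρ v g + b

/-- The Fubini–Study distance on `ℙ(V ⊕ W)` for the orthogonal direct sum of the Hermitian norms:
the angle in `[0, π/2]` between two complex lines. -/
def fubiniStudy (p q : ℙ ℂ (V × W)) : ℝ :=
  Real.arccos (‖inner ℂ (WithLp.toLp 2 p.rep) (WithLp.toLp 2 q.rep)‖ /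
    (‖WithLp.toLp 2 p.rep‖ * ‖WithLp.toLp 2 q.rep‖))

/-- The Fubini–Study distance between the closures of the orbits of `[(v, w)]` and `[(v, 0)]`. -/
def orbitDist {H : Type*} [Group H] (ρ : Representation ℂ H V) (σ : Representation ℂ H W) (v : V)
    (w : W) : ℝ :=
  sInf (Set.image2 fubiniStudy (zariskiClosure (projOrbit (ρ.prod σ) (v, w)))
    (zariskiClosure (projOrbit (ρ.prod σ) (v, (0 : W)))))

end Energy

end StablePairs

end

/-! Every assertion reduces to inequalities between norms along the orbit of `G`. The bridge is the
equality of the Zariski and Euclidean closures of a projective orbit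
(`mem_zariskiClosure_projOrbit_iff`). It comes from `mem_closure_image_of_forall_eval_eq_zero`: the
Zariski closure of a polynomial image lies in the Euclidean closure. That in turn combines
Chevalley's theorem (the image contains a nonempty open part of each component of its closure) with
the Euclidean density of such open parts.

With this and compactness of the unit sphere, `(v, w)` is semistable exactly when `c ‖g v‖ ≤ ‖g w‖`
for some `c > 0` and all `g` (`semistable_iff_exists_norm_le`). Taking logarithms gives part 1. For
part 3, let `m` be the infimum of `‖g w‖ / ‖g v‖`. Points of the first closure satisfy `m ‖a‖ ≤
‖b‖`, so by Cauchy–Schwarz their angle with `V ⊕ 0` is at least `arctan m`, while the pairs `g [(v,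
w)]`, `g [(v, 0)]` realize the angles `arctan (‖g w‖ / ‖g v‖)`.

For part 2, sup norms in product bases are multiplicative on tensors, so stability with parameter
`m` says that `‖g‖^q ‖g v‖^m` is bounded by a multiple of `‖g w‖^(m+1)`. In logarithms this is
properness with `ε = 1/(m+1)`. To pass from an arbitrary `ε` to one of this form, `J_v` must be
bounded below, and this is where the degree matters.

The lower bound of `J_v` (`bddBelow_range_aubin`) uses the polar decomposition `g = k p` inside `G`,
with `p` in a maximal torus: the complex powers of `gᴴ g` lie in a torus because its integer powers
lie in an algebraic group. The inclusion of weight polytopes in `q 𝒩(𝕀)` bounds the exponential rate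
of `p` on `V` by `q` times its rate on `ℂⁿ`. The torus varies with `g`, so the constant must not
depend on it; Phragmén–Lindelöf supplies a uniform one from the action of unitary elements. -/

namespace StablePairs

/-! ### Density of the image of a morphism of affine varieties -/

section Density

open Filter Topology

/-- Nullstellensatz: a maximal ideal of a finitely generated `ℂ`-algebra is the kernel of a point. -/
theorem exists_algHom_ker_eq {A : Type*} [CommRing A] [Algebra ℂ A] [Algebra.FiniteType ℂ A]
    (m : Ideal A) [hm : m.IsMaximal] : ∃ x : A →ₐ[ℂ] ℂ, ∀ a, x a = 0 ↔ a ∈ m := by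
  let _ := Ideal.Quotient.field m
  have : Module.Finite ℂ (A ⧸ m) := finite_of_finite_type_of_isJacobsonRing ℂ (A ⧸ m)
  have hb : Function.Bijective (algebraMap ℂ (A ⧸ m)) :=
    IsAlgClosed.algebraMap_bijective_of_isIntegral
  let e : ℂ ≃ₐ[ℂ] (A ⧸ m) := AlgEquiv.ofBijective (Algebra.ofId ℂ (A ⧸ m)) hb
  refine ⟨(e.symm : (A ⧸ m) →ₐ[ℂ] ℂ).comp (Ideal.Quotient.mkₐ ℂ m), fun a => ?_⟩
  simp [Ideal.Quotient.eq_zero_iff_mem]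

theorem algHom_eq_of_ker_le {A : Type*} [CommRing A] [Algebra ℂ A] {x y : A →ₐ[ℂ] ℂ}
    (h : ∀ a, x a = 0 → y a = 0) (a : A) : y a = x a := by
  have h1 : x (a - algebraMap ℂ A (x a)) = 0 := by simp
  have := h _ h1
  simpa [sub_eq_zero] using this

theorem isMaximal_ker_algHom {A : Type*} [CommRing A] [Algebra ℂ A] (x : A →ₐ[ℂ] ℂ) :
    (RingHom.ker (x : A →+* ℂ)).IsMaximal :=
  RingHom.ker_isMaximal_of_surjective _ fun z => ⟨algebraMap ℂ A z, by simp⟩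

/-- Generic extension of points along an injective map of finitely generated algebras. -/
theorem exists_ne_zero_forall_algHom_extend {A B : Type*} [CommRing A] [IsDomain A] [Algebra ℂ A]
    [Algebra.FiniteType ℂ A] [CommRing B] [Algebra ℂ B] [Algebra.FiniteType ℂ B] [Algebra A B]
    [IsScalarTower ℂ A B] (hinj : Function.Injective (algebraMap A B)) :
    ∃ f : A, f ≠ 0 ∧ ∀ x : A →ₐ[ℂ] ℂ, x f ≠ 0 →
      ∃ y : B →ₐ[ℂ] ℂ, ∀ a, y (algebraMap A B a) = x a := by
  have : IsNoetherianRing A := Algebra.FiniteType.isNoetherianRing ℂ A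
  have hft : Algebra.FiniteType A B := Algebra.FiniteType.of_restrictScalars_finiteType ℂ A B
  have hfp : (algebraMap A B).FinitePresentation := by
    rw [RingHom.finitePresentation_algebraMap]
    exact Algebra.FinitePresentation.of_finiteType.mp hft
  have hc := PrimeSpectrum.isConstructible_range_comap hfp
  obtain ⟨S, hS⟩ := PrimeSpectrum.exists_constructibleSetData_iff.mpr hc
  -- Injectivity puts the generic point of `Spec A` in the constructible image. The locally closed
  -- piece containing it must be a basic open set, whose equation is the required `f`.
  obtain ⟨p', hp', hcomap⟩ := Ideal.exists_comap_eq_of_mem_minimalPrimes_of_injective hinj ⊥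
    (by simp [IsDomain.minimalPrimes_eq_singleton_bot])
  have hbot : (⟨⊥, Ideal.isPrime_bot⟩ : PrimeSpectrum A) ∈ S.toSet := by
    rw [hS]
    exact ⟨⟨p', hp'⟩, PrimeSpectrum.ext hcomap⟩
  simp only [PrimeSpectrum.ConstructibleSetData.toSet, Set.mem_iUnion] at hbot
  obtain ⟨D, hD, h⟩ := hbot
  refine ⟨D.f, ?_, fun x hx => ?_⟩
  · intro h0
    apply h.2
    simp [h0]
  have hmax := isMaximal_ker_algHom x
  have hmem : (⟨RingHom.ker (x : A →+* ℂ), hmax.isPrime⟩ : PrimeSpectrum A) ∈ S.toSet := by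
    simp only [PrimeSpectrum.ConstructibleSetData.toSet, Set.mem_iUnion]
    refine ⟨D, hD, ?_, ?_⟩
    · rw [PrimeSpectrum.mem_zeroLocus]
      have h1 := h.1
      rw [PrimeSpectrum.mem_zeroLocus] at h1
      exact h1.trans (SetLike.coe_subset_coe.mpr bot_le)
    · simpa [PrimeSpectrum.mem_zeroLocus, RingHom.mem_ker] using hx
  rw [hS] at hmem
  obtain ⟨Q, hQ⟩ := hmem
  have hQ' : Q.asIdeal.comap (algebraMap A B) = RingHom.ker (x : A →+* ℂ) :=
    congrArg PrimeSpectrum.asIdeal hQ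
  -- Enlarging `Q` does no harm: a point of `B` whose kernel contracts to something containing `ker
  -- x` already restricts to `x`.
  obtain ⟨m, hm, hle⟩ := Ideal.exists_le_maximal Q.asIdeal Q.isPrime.ne_top
  obtain ⟨y, hy⟩ := exists_algHom_ker_eq m
  refine ⟨y, fun a => ?_⟩
  refine algHom_eq_of_ker_le (x := x) (y := y.comp (IsScalarTower.toAlgHom ℂ A B)) ?_ a
  intro a ha
  have : a ∈ Q.asIdeal.comap (algebraMap A B) := by
    rw [hQ']; simpa [RingHom.mem_ker] using ha
  simpa [hy] using hle this

/-- A nonzero polynomial is nonzero at points converging to a given point. -/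
theorem exists_tendsto_eval_ne_zero {r : ℕ} (z : Fin r → ℂ) {g : MvPolynomial (Fin r) ℂ}
    (hg : g ≠ 0) : ∃ u : ℕ → Fin r → ℂ, Tendsto u atTop (𝓝 z) ∧ ∀ k, g.eval (u k) ≠ 0 := by
  have h : ∀ k : ℕ, ∃ u : Fin r → ℂ, dist u z ≤ 1 / ((k : ℝ) + 1) ∧ g.eval u ≠ 0 := by
    intro k
    by_contra! hcon
    apply hg
    have hpos : (0 : ℝ) < 1 / ((k : ℝ) + 1) := by positivity
    refine MvPolynomial.funext_set (fun i => Metric.closedBall (z i) (1 / ((k : ℝ) + 1))) ?_ ?_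
    · intro i
      exact infinite_of_mem_nhds (z i) (Metric.closedBall_mem_nhds _ hpos)
    · intro u hu
      rw [hcon u ((dist_pi_le_iff hpos.le).mpr fun i => hu i trivial), map_zero]
  choose u hu hgu using h
  refine ⟨u, ?_, hgu⟩
  rw [tendsto_iff_dist_tendsto_zero]
  exact squeeze_zero (fun _ => dist_nonneg) hu tendsto_one_div_add_atTop_nhds_zero_nat

/-- A monic complex polynomial has a root bounded by its constant coefficient. -/
theorem exists_root_norm_pow_le (F : Polynomial ℂ) (hF : F.Monic) (hd : 0 < F.natDegree) :
    ∃ t, F.IsRoot t ∧ ‖t‖ ^ F.natDegree ≤ ‖F.coeff 0‖ := by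
  have hs := IsAlgClosed.splits F
  have hcard : F.roots.card = F.natDegree := hs.natDegree_eq_card_roots.symm
  have hprod : ‖F.coeff 0‖ = (F.roots.map fun x => ‖x‖).prod := by
    rw [hs.coeff_zero_eq_prod_roots_of_monic hF, norm_mul, norm_pow, norm_neg, norm_one, one_pow,
      one_mul]
    exact map_multiset_prod (normHom : ℂ →*₀ ℝ) F.roots
  by_contra! hcon
  have hne : F.roots ≠ 0 := by
    rw [← Multiset.card_pos, hcard]; exact hd
  obtain ⟨t, ht, hmin⟩ := Finset.exists_min_image F.roots.toFinset (fun x => ‖x‖)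
    (by simpa using hne)
  have htr : F.IsRoot t := Polynomial.isRoot_of_mem_roots (Multiset.mem_toFinset.mp ht)
  refine absurd (hcon t htr) (not_lt.mpr ?_)
  have := Multiset.prod_map_le_prod_map₀ (s := F.roots) (fun _ => ‖t‖) (fun x => ‖x‖)
    (fun _ _ => norm_nonneg _) fun x hx => hmin x (Multiset.mem_toFinset.mpr hx)
  rwa [Multiset.map_const', Multiset.prod_replicate, hcard, ← hprod] at this

theorem exists_tendsto_hyperfilter_of_bounded (h : ℕ → ℂ) (R : ℝ) (hR : ∀ k, ‖h k‖ ≤ R) :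
    ∃ L, Tendsto h (hyperfilter ℕ : Filter ℕ) (𝓝 L) := by
  obtain ⟨L, -, hL⟩ := (isCompact_closedBall (0 : ℂ) R).ultrafilter_le_nhds
    ((hyperfilter ℕ).map h) (by
      rw [le_principal_iff]
      exact Filter.Eventually.of_forall (f := (hyperfilter ℕ : Filter ℕ)) fun k => by simpa using hR k)
  exact ⟨L, hL⟩

/-- Points of an irreducible affine variety at which a given nonzero function does not vanish are
dense for the Euclidean topology. -/
theorem exists_tendsto_algHom_ne_zero {A : Type*} [CommRing A] [IsDomain A] [Algebra ℂ A]
    [Algebra.FiniteType ℂ A] (x : A →ₐ[ℂ] ℂ) {f : A} (hf : f ≠ 0) :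
    ∃ y : ℕ → A →ₐ[ℂ] ℂ, (∀ k, y k f ≠ 0) ∧
      ∀ a, Tendsto (fun k => y k a) (hyperfilter ℕ : Filter ℕ) (𝓝 (x a)) := by
  -- Noether normalization: nearby points are easy to choose in affine space and lift along the
  -- finite map. The difficulty is to make the lifts converge to `x` and not to another point of its
  -- fibre.
  obtain ⟨r, φ, hinj, hfin⟩ := exists_finite_inj_algHom_of_fg ℂ A
  let _ : Algebra (MvPolynomial (Fin r) ℂ) A := φ.toRingHom.toAlgebra
  have hmap : ∀ p, algebraMap (MvPolynomial (Fin r) ℂ) A p = φ p := fun _ => rfl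
  have : IsScalarTower ℂ (MvPolynomial (Fin r) ℂ) A :=
    IsScalarTower.of_algebraMap_eq fun z => by
      rw [hmap, MvPolynomial.algebraMap_eq, ← MvPolynomial.algebraMap_eq, AlgHom.commutes]
  have : Module.Finite (MvPolynomial (Fin r) ℂ) A := hfin
  have : Algebra.IsIntegral (MvPolynomial (Fin r) ℂ) A := inferInstance
  have : FaithfulSMul (MvPolynomial (Fin r) ℂ) A :=
    (faithfulSMul_iff_algebraMap_injective _ _).mpr hinj
  have hquasi : Algebra.QuasiFinite (MvPolynomial (Fin r) ℂ) A := inferInstance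
  have hint : ∀ a : A, IsIntegral (MvPolynomial (Fin r) ℂ) a := Algebra.IsIntegral.isIntegral
  -- Since `f` divides a nonzero `g` from the base, it does not vanish at any lift of a point where
  -- `g` does not vanish.
  obtain ⟨g, hg0, f', hff'⟩ := (hint f).isAlgebraic.exists_nonzero_dvd
    (mem_nonZeroDivisors_of_ne_zero hf)
  obtain ⟨z, hz, hgz⟩ := exists_tendsto_eval_ne_zero (fun i => x (φ (MvPolynomial.X i))) hg0
  have hxR : ∀ p, x (algebraMap (MvPolynomial (Fin r) ℂ) A p) =
      p.eval fun i => x (φ (MvPolynomial.X i)) := by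
    intro p
    have : (x.comp φ) = MvPolynomial.aeval fun i => x (φ (MvPolynomial.X i)) := by
      ext i; simp
    have h2 := DFunLike.congr_fun this p
    rw [MvPolynomial.aeval_eq_eval] at h2
    simpa [hmap] using h2
  have hcont : ∀ p : MvPolynomial (Fin r) ℂ, Tendsto (fun k => p.eval (z k)) atTop
      (𝓝 (p.eval fun i => x (φ (MvPolynomial.X i)))) := fun p =>
    ((MvPolynomial.continuous_eval p).tendsto _).comp hz
  have hxmax := isMaximal_ker_algHom x
  set I := RingHom.ker (x : A →+* ℂ) with hI
  -- Prime avoidance in the finite fibre: `u` vanishes at `x` and at no other point over the same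
  -- base point. Lifts along which `u` tends to `0` can therefore only accumulate at `x`.
  obtain ⟨u, huI, hu⟩ : ∃ u ∈ I, ∀ Q ∈ (I.under (MvPolynomial (Fin r) ℂ)).primesOver A,
      u ∈ Q → I ≤ Q := by
    have hfinP := Algebra.QuasiFinite.finite_primesOver (S := A)
      (I.under (MvPolynomial (Fin r) ℂ))
    classical
    by_contra! hcon
    let s := hfinP.toFinset.filter fun Q => ¬ I ≤ Q
    have hsub : (I : Set A) ⊆ ⋃ Q ∈ (↑s : Set (Ideal A)), (Q : Set A) := by
      intro u hu
      obtain ⟨Q, hQ, huQ, hIQ⟩ := hcon u hu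
      exact Set.mem_biUnion (by simpa [s] using ⟨hQ, hIQ⟩) huQ
    obtain ⟨Q, hQs, hIQ⟩ := (Ideal.subset_union_prime (s := s) (f := id) ⊥ ⊥ fun Q hQ _ _ => by
      have : Q ∈ (I.under (MvPolynomial (Fin r) ℂ)).primesOver A := by
        simp [s] at hQ; exact hQ.1
      exact this.1).mp hsub
    simp [s] at hQs
    exact hQs.2 hIQ
  have hxu : x u = 0 := by simpa [hI, RingHom.mem_ker] using huI
  set F := minpoly (MvPolynomial (Fin r) ℂ) u with hF
  have hFm : F.Monic := minpoly.monic (hint u)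
  have hFd : 0 < F.natDegree := minpoly.natDegree_pos (hint u)
  -- The prescribed values of `u` at the lifts are these small roots: the constant coefficient of
  -- `F` tends to `0` because `u` vanishes at `x`.
  have hroot : ∀ k, ∃ t : ℂ, (F.map (MvPolynomial.eval (z k))).IsRoot t ∧
      ‖t‖ ^ F.natDegree ≤ ‖(F.coeff 0).eval (z k)‖ := by
    intro k
    obtain ⟨t, ht, hle⟩ := exists_root_norm_pow_le (F.map (MvPolynomial.eval (z k)))
      (hFm.map _) (by rwa [hFm.natDegree_map])
    refine ⟨t, ht, ?_⟩
    rwa [hFm.natDegree_map, Polynomial.coeff_map] at hle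
  choose t ht htle using hroot
  have hF0 : (F.coeff 0).eval (fun i => x (φ (MvPolynomial.X i))) = 0 := by
    have h1 := congrArg x (minpoly.aeval (MvPolynomial (Fin r) ℂ) u)
    rw [← hF, Polynomial.aeval_eq_sum_range, map_sum, Finset.sum_eq_single 0] at h1
    · rw [Algebra.smul_def, map_mul, hxR] at h1
      simpa using h1
    · intro i _ hi
      rw [Algebra.smul_def, map_mul, map_pow, hxu, zero_pow hi, mul_zero]
    · intro h; exact absurd (Finset.mem_range.mpr (Nat.succ_pos _)) h
  have httend : Tendsto t atTop (𝓝 0) := by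
    rw [tendsto_zero_iff_norm_tendsto_zero]
    have h1 : Tendsto (fun k => ‖t k‖ ^ F.natDegree) atTop (𝓝 0) := by
      refine squeeze_zero (fun _ => by positivity) htle ?_
      have := (hcont (F.coeff 0)).norm
      rwa [hF0, norm_zero] at this
    have h2 := h1.rpow_const (p := ((F.natDegree : ℝ)⁻¹)) (Or.inr (by positivity))
    have hne : (F.natDegree : ℝ)⁻¹ ≠ 0 := by positivity
    rw [Real.zero_rpow hne] at h2
    refine h2.congr fun k => ?_
    exact Real.pow_rpow_inv_natCast (norm_nonneg _) hFd.ne'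
  have hlift : ∀ k, ∃ y : A →ₐ[ℂ] ℂ,
      (∀ p, y (algebraMap (MvPolynomial (Fin r) ℂ) A p) = p.eval (z k)) ∧ y u = t k := by
    intro k
    have hev : F.eval₂ (MvPolynomial.eval (z k)) (t k) = 0 := by
      rw [← Polynomial.eval_map]; exact ht k
    -- Polynomial rings are integrally closed, so the subalgebra generated by `u` is the quotient by
    -- its minimal polynomial `F`. The root `t k` defines a point of it, which extends to `A` by
    -- integrality.
    let e := minpoly.equivAdjoin (hint u)
    let ψ : Algebra.adjoin (MvPolynomial (Fin r) ℂ) {u} →+* ℂ :=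
      (AdjoinRoot.lift (MvPolynomial.eval (z k)) (t k) hev).comp (e.symm : _ →+* _)
    have hψR : ∀ p : MvPolynomial (Fin r) ℂ, ψ (algebraMap _ _ p) = p.eval (z k) := by
      intro p
      have : e.symm (algebraMap _ _ p) = AdjoinRoot.of F p := by
        rw [AlgEquiv.commutes]; rfl
      simp only [ψ, RingHom.comp_apply, RingHom.coe_coe, this, AdjoinRoot.lift_of]
    have hψu : ψ ⟨u, Algebra.self_mem_adjoin_singleton _ u⟩ = t k := by
      have : e.symm ⟨u, Algebra.self_mem_adjoin_singleton _ u⟩ = AdjoinRoot.root F := by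
        rw [AlgEquiv.symm_apply_eq]
        simp [e, AdjoinRoot.Minpoly.toAdjoin, AdjoinRoot.liftAlgHom, F]
      simp only [ψ, RingHom.comp_apply, RingHom.coe_coe, this, AdjoinRoot.lift_root]
    have hsurj : Function.Surjective ψ := fun c => ⟨algebraMap _ _ (MvPolynomial.C c),
      (hψR _).trans (MvPolynomial.eval_C c)⟩
    have hMmax : (RingHom.ker ψ).IsMaximal := RingHom.ker_isMaximal_of_surjective _ hsurj
    have : Algebra.IsIntegral (Algebra.adjoin (MvPolynomial (Fin r) ℂ) {u}) A :=
      Algebra.IsIntegral.tower_top (R := MvPolynomial (Fin r) ℂ)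
    obtain ⟨Q, hQ, hQM⟩ := Ideal.exists_ideal_over_maximal_of_isIntegral
      (S := A) (RingHom.ker ψ) (by
        rw [(RingHom.injective_iff_ker_eq_bot _).mp (fun a b h => Subtype.ext h)]
        exact bot_le)
    obtain ⟨y, hy⟩ := exists_algHom_ker_eq Q
    have key : ∀ s : Algebra.adjoin (MvPolynomial (Fin r) ℂ) {u}, y s = ψ s := by
      intro s
      have h1 : s - algebraMap (MvPolynomial (Fin r) ℂ) _ (MvPolynomial.C (ψ s)) ∈ RingHom.ker ψ := by
        simp [RingHom.mem_ker, hψR]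
      rw [← hQM, Ideal.mem_comap, ← hy, map_sub, map_sub, sub_eq_zero] at h1
      rw [show y (s : A) = y (algebraMap _ A s) from rfl, h1, ← IsScalarTower.algebraMap_apply,
        ← MvPolynomial.algebraMap_eq, ← IsScalarTower.algebraMap_apply, AlgHom.commutes]
      rfl
    refine ⟨y, fun p => ?_, ?_⟩
    · rw [← hψR, ← key]; rfl
    · rw [← hψu, ← key]
  choose y hyR hyu using hlift
  refine ⟨y, fun k hk => ?_, ?_⟩
  · apply hgz k
    rw [← hyR, hff', map_mul, hk, zero_mul]
  -- The values `y k a` are roots of monic polynomials with convergent coefficients. Being bounded,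
  -- they converge for all `a` at once along the ultrafilter, and the limits form a point `Y`.
  have hbdd : ∀ a, ∃ R, ∀ k, ‖y k a‖ ≤ R := by
    intro a
    set P := minpoly (MvPolynomial (Fin r) ℂ) a with hP
    have hPm : P.Monic := minpoly.monic (hint a)
    have hPa : ∀ k, (P.map (MvPolynomial.eval (z k))).IsRoot (y k a) := by
      intro k
      have h1 := congrArg (y k) (minpoly.aeval (MvPolynomial (Fin r) ℂ) a)
      rw [map_zero, Polynomial.aeval_def, ← AlgHom.coe_toRingHom, Polynomial.hom_eval₂] at h1
      rw [Polynomial.IsRoot, Polynomial.eval_map, ← h1]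
      congr 1
      ext p
      · simp [hyR]
      · simp [hyR]
    have hs : Tendsto (fun k => ∑ i ∈ Finset.range P.natDegree, ‖(P.coeff i).eval (z k)‖) atTop
        (𝓝 (∑ i ∈ Finset.range P.natDegree,
          ‖(P.coeff i).eval fun i => x (φ (MvPolynomial.X i))‖)) :=
      tendsto_finsetSum _ fun i _ => (hcont _).norm
    obtain ⟨R, hR⟩ := hs.bddAbove_range
    refine ⟨R + 1, fun k => ?_⟩
    have hPk : (P.map (MvPolynomial.eval (z k))).Monic := hPm.map _
    have h1 := (hPa k).norm_lt_cauchyBound hPk.ne_zero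
    refine (NNReal.coe_le_coe.mpr h1.le).trans ?_
    have hRk := hR ⟨k, rfl⟩
    have hR0 : 0 ≤ R := le_trans (Finset.sum_nonneg fun _ _ => norm_nonneg _) hRk
    rw [Polynomial.cauchyBound, hPk.leadingCoeff, nnnorm_one, div_one, hPm.natDegree_map]
    push_cast
    gcongr
    rw [← Real.coe_toNNReal R hR0, NNReal.coe_le_coe, Finset.sup_le_iff]
    intro i hi
    rw [← NNReal.coe_le_coe, Real.coe_toNNReal R hR0, coe_nnnorm, Polynomial.coeff_map]
    exact le_trans (Finset.single_le_sum
      (f := fun i => ‖(P.coeff i).eval (z k)‖) (fun _ _ => norm_nonneg _) hi) hRk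
  have hlim : ∀ a, ∃ L, Tendsto (fun k => y k a) (hyperfilter ℕ : Filter ℕ) (𝓝 L) := fun a =>
    let ⟨R, hR⟩ := hbdd a
    exists_tendsto_hyperfilter_of_bounded _ R hR
  choose L hL using hlim
  let Y : A →ₐ[ℂ] ℂ :=
    { toFun := L
      map_one' := tendsto_nhds_unique (hL 1) (by simp)
      map_zero' := tendsto_nhds_unique (hL 0) (by simp)
      map_mul' := fun a b => tendsto_nhds_unique (hL _) (by simpa using (hL a).mul (hL b))
      map_add' := fun a b => tendsto_nhds_unique (hL _) (by simpa using (hL a).add (hL b))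
      commutes' := fun c => tendsto_nhds_unique (hL _) (by simp) }
  have hhyp : (hyperfilter ℕ : Filter ℕ) ≤ atTop := Nat.hyperfilter_le_atTop
  have hYR : ∀ p, Y (algebraMap (MvPolynomial (Fin r) ℂ) A p) =
      x (algebraMap (MvPolynomial (Fin r) ℂ) A p) := by
    intro p
    refine tendsto_nhds_unique (hL _) ?_
    simp only [hyR, hxR]
    exact (hcont p).mono_left hhyp
  have hYu : Y u = 0 := by
    refine tendsto_nhds_unique (hL _) ?_
    simp only [hyu]
    exact httend.mono_left hhyp
  have hYprime : RingHom.ker (Y : A →+* ℂ) ∈ (I.under (MvPolynomial (Fin r) ℂ)).primesOver A := by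
    refine ⟨(isMaximal_ker_algHom Y).isPrime, ⟨?_⟩⟩
    ext p
    simp only [Ideal.under, Ideal.mem_comap, hI, RingHom.mem_ker, RingHom.coe_coe, hYR]
  have hle := hu _ hYprime (by simpa [RingHom.mem_ker] using hYu)
  intro a
  have : Y a = x a := algHom_eq_of_ker_le (fun b hb => by
    have := @hle b (by simpa [hI, RingHom.mem_ker] using hb)
    simpa [RingHom.mem_ker] using this) a
  rw [← this]
  exact hL a

/-- The Zariski closure of the image of an affine variety under a polynomial map is contained in
the Euclidean closure of the image. -/
theorem mem_closure_image_of_forall_eval_eq_zero {σ τ : Type*} [Finite σ] [Finite τ]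
    (E : Set (MvPolynomial σ ℂ)) (φ : τ → MvPolynomial σ ℂ) (p : τ → ℂ)
    (hp : ∀ P : MvPolynomial τ ℂ, (∀ x : σ → ℂ, (∀ e ∈ E, e.eval x = 0) →
      P.eval (fun j => (φ j).eval x) = 0) → P.eval p = 0) :
    p ∈ closure ((fun (x : σ → ℂ) j => (φ j).eval x) '' {x | ∀ e ∈ E, e.eval x = 0}) := by
  -- The full vanishing ideal of the source, not the ideal generated by `E`: membership is then
  -- vanishing on the variety by definition.
  let I : Ideal (MvPolynomial σ ℂ) := ⨅ x ∈ {x : σ → ℂ | ∀ e ∈ E, e.eval x = 0},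
    RingHom.ker (MvPolynomial.eval x)
  have hI : ∀ P, P ∈ I ↔ ∀ x : σ → ℂ, (∀ e ∈ E, e.eval x = 0) → P.eval x = 0 := by
    intro P
    simp [I, RingHom.mem_ker]
  let Φ : MvPolynomial τ ℂ →ₐ[ℂ] MvPolynomial σ ℂ := MvPolynomial.aeval φ
  have hΦ : ∀ P (x : σ → ℂ), (Φ P).eval x = P.eval fun j => (φ j).eval x := by
    intro P x
    have : (MvPolynomial.eval x).comp (Φ : MvPolynomial τ ℂ →+* MvPolynomial σ ℂ) =
        MvPolynomial.eval fun j => (φ j).eval x := by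
      ext <;> simp [Φ]
    exact DFunLike.congr_fun this P
  let m : Ideal (MvPolynomial τ ℂ) := RingHom.ker (MvPolynomial.eval p)
  have hm : m.IsPrime := RingHom.ker_isPrime _
  have hKm : I.comap (Φ : MvPolynomial τ ℂ →+* MvPolynomial σ ℂ) ≤ m := by
    intro P hP
    rw [Ideal.mem_comap, hI] at hP
    exact hp P fun x hx => by rw [← hΦ]; exact hP x hx
  -- Passes to an irreducible component of the closure of the image through `p`, and to an
  -- irreducible closed subset of the source dominating it. The coordinate rings are domains and the
  -- map between them is injective.
  obtain ⟨q, hq, hqm⟩ := Ideal.exists_minimalPrimes_le hKm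
  obtain ⟨p', hp', hIp', hcomap⟩ := Ideal.exists_comap_eq_of_mem_minimalPrimes _ q hq
  have hqp : q.IsPrime := hq.1.1
  let ι : (MvPolynomial τ ℂ ⧸ q) →ₐ[ℂ] (MvPolynomial σ ℂ ⧸ p') :=
    Ideal.quotientMapₐ p' Φ hcomap.ge
  have hι : ∀ P, ι (Ideal.Quotient.mk q P) = Ideal.Quotient.mk p' (Φ P) := fun P => rfl
  let _ : Algebra (MvPolynomial τ ℂ ⧸ q) (MvPolynomial σ ℂ ⧸ p') := ι.toRingHom.toAlgebra
  have : IsScalarTower ℂ (MvPolynomial τ ℂ ⧸ q) (MvPolynomial σ ℂ ⧸ p') :=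
    IsScalarTower.of_algebraMap_eq fun z => (ι.commutes z).symm
  have hinj : Function.Injective (algebraMap (MvPolynomial τ ℂ ⧸ q) (MvPolynomial σ ℂ ⧸ p')) :=
    Ideal.quotientMap_injective' (H := hcomap.ge) hcomap.le
  obtain ⟨f, hf0, hf⟩ := exists_ne_zero_forall_algHom_extend hinj
  let x : (MvPolynomial τ ℂ ⧸ q) →ₐ[ℂ] ℂ := Ideal.Quotient.liftₐ q (MvPolynomial.aeval p)
    fun a ha => by
      have := hqm ha
      rwa [RingHom.mem_ker] at this
  obtain ⟨y, hy0, hy⟩ := exists_tendsto_algHom_ne_zero x hf0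
  choose Y hY using fun k => hf (y k) (hy0 k)
  let ξ : ℕ → σ → ℂ := fun k i => Y k (Ideal.Quotient.mk p' (MvPolynomial.X i))
  have hξ : ∀ k P, MvPolynomial.eval (ξ k) P = Y k (Ideal.Quotient.mk p' P) := by
    intro k P
    have : MvPolynomial.aeval (ξ k) = (Y k).comp (Ideal.Quotient.mkₐ ℂ p') := by
      ext i; simp [ξ]
    have h2 := DFunLike.congr_fun this P
    rw [MvPolynomial.aeval_eq_eval] at h2
    simpa using h2
  refine mem_closure_of_tendsto (f := fun k j => (φ j).eval (ξ k))
    (b := (hyperfilter ℕ : Filter ℕ)) (tendsto_pi_nhds.mpr fun j => ?_)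
    (Eventually.of_forall fun k => ⟨ξ k, fun e he => ?_, rfl⟩)
  · have h1 := hy (Ideal.Quotient.mk q (MvPolynomial.X j))
    have h2 : x (Ideal.Quotient.mk q (MvPolynomial.X j)) = p j := by
      change MvPolynomial.aeval p (MvPolynomial.X j) = p j
      simp
    rw [h2] at h1
    refine h1.congr fun k => ?_
    rw [hξ, ← hY]
    change Y k (ι _) = _
    rw [hι]
    simp [Φ]
  · rw [hξ, Ideal.Quotient.eq_zero_iff_mem.mpr, map_zero]
    exact hIp' ((hI e).mpr fun x hx => hx e he)

end Density

variable {n : ℕ} {G : Subgroup (Matrix.SpecialLinearGroup (Fin n) ℂ)}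

/-! ### Zariski and Euclidean closures of orbits -/

section Closures

open Filter Topology

/-- The entries of a matrix, as a point of affine space. -/
def entries (A : Matrix (Fin n) (Fin n) ℂ) : Fin n × Fin n → ℂ := fun ij => A ij.1 ij.2

/-- `G` is the set of common zeros of polynomials in the matrix entries. -/
def IsAlgebraicGroup (G : Subgroup (Matrix.SpecialLinearGroup (Fin n) ℂ)) : Prop :=
  ∃ E : Set (MvPolynomial (Fin n × Fin n) ℂ), ∀ A : Matrix (Fin n) (Fin n) ℂ,
    (∃ g : G, toMat g = A) ↔ ∀ P ∈ E, MvPolynomial.eval (entries A) P = 0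

theorem IsRational.exists_polynomial {V : Type*} [AddCommGroup V] [Module ℂ V]
    {ρ : Representation ℂ G V} (hρ : IsRational ρ) (l : Module.Dual ℂ V) (x : V) :
    ∃ P : MvPolynomial (Fin n × Fin n) ℂ, ∀ g : G,
      l (ρ g x) = MvPolynomial.eval (entries (toMat g)) P := by
  obtain ⟨P, hP⟩ := hρ l x
  exact ⟨P, fun g => hP ⟨g, trivial⟩⟩

theorem isRational_of_exists_polynomial {V : Type*} [AddCommGroup V] [Module ℂ V]
    {ρ : Representation ℂ G V}
    (h : ∀ (l : Module.Dual ℂ V) (x : V), ∃ P : MvPolynomial (Fin n × Fin n) ℂ, ∀ g : G,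
      l (ρ g x) = MvPolynomial.eval (entries (toMat g)) P) : IsRational ρ := by
  intro l x
  obtain ⟨P, hP⟩ := h l x
  exact ⟨P, fun g => hP g⟩

variable {V W : Type*} [AddCommGroup V] [Module ℂ V] [AddCommGroup W] [Module ℂ W]

theorem IsRational.prod {ρ : Representation ℂ G V} {σ : Representation ℂ G W} (hρ : IsRational ρ)
    (hσ : IsRational σ) : IsRational (ρ.prod σ) := by
  refine isRational_of_exists_polynomial fun l x => ?_
  obtain ⟨P, hP⟩ := hρ.exists_polynomial (l ∘ₗ LinearMap.inl ℂ V W) x.1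
  obtain ⟨Q, hQ⟩ := hσ.exists_polynomial (l ∘ₗ LinearMap.inr ℂ V W) x.2
  refine ⟨P + Q, fun g => ?_⟩
  rw [map_add, ← hP, ← hQ]
  simp [← map_add]

theorem eval_smul_of_isHomogeneous {ι : Type*} {d : ℕ} {Q : MvPolynomial ι ℂ} (hQ : Q.IsHomogeneous d)
    (s : ℂ) (y : ι → ℂ) :
    MvPolynomial.eval (s • y) Q = s ^ d * MvPolynomial.eval y Q := by
  rw [MvPolynomial.eval_eq, MvPolynomial.eval_eq, Finset.mul_sum]
  refine Finset.sum_congr rfl fun m hm => ?_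
  have hd := hQ (MvPolynomial.mem_support_iff.mp hm)
  simp only [Pi.smul_apply, smul_eq_mul, mul_pow, Finset.prod_mul_distrib]
  rw [Finset.prod_pow_eq_pow_sum]
  have : ∑ i ∈ m.support, m i = d := by
    rw [← hd, Finsupp.weight_apply, Finsupp.sum]; simp
  rw [this]; ring

theorem eval_smul_eq_sum {ι : Type*} (Q : MvPolynomial ι ℂ) (s : ℂ) (y : ι → ℂ) :
    MvPolynomial.eval (s • y) Q = ∑ k ∈ Finset.range (Q.totalDegree + 1),
      s ^ k * MvPolynomial.eval y (MvPolynomial.homogeneousComponent k Q) := by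
  conv_lhs => rw [← MvPolynomial.sum_homogeneousComponent Q]
  rw [map_sum]
  exact Finset.sum_congr rfl fun k _ =>
    eval_smul_of_isHomogeneous (MvPolynomial.homogeneousComponent_isHomogeneous k Q) s y

theorem polyEval_smul {d : ℕ} {P : MvPolynomial (Module.Dual ℂ V) ℂ} (hP : P.IsHomogeneous d)
    (s : ℂ) (x : V) : polyEval P (s • x) = s ^ d * polyEval P x := by
  have : (fun l : Module.Dual ℂ V => l (s • x)) = s • fun l : Module.Dual ℂ V => l x := by
    ext l; simp
  rw [polyEval, this, eval_smul_of_isHomogeneous hP, polyEval]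

theorem polyEval_mk_rep_eq_zero_iff {d : ℕ} {P : MvPolynomial (Module.Dual ℂ V) ℂ}
    (hP : P.IsHomogeneous d) {y : V} (hy : y ≠ 0) :
    polyEval P (Projectivization.mk ℂ y hy).rep = 0 ↔ polyEval P y = 0 := by
  obtain ⟨a, ha⟩ := Projectivization.exists_smul_eq_mk_rep ℂ y hy
  rw [← ha, Units.smul_def, polyEval_smul hP]
  simp

theorem polyEval_eq_zero_of_mem_projOrbit {τ : Representation ℂ G V} {x : V} (hx : x ≠ 0) {d : ℕ}
    {P : MvPolynomial (Module.Dual ℂ V) ℂ} (hP : P.IsHomogeneous d) :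
    (∀ s ∈ projOrbit τ x, polyEval P s.rep = 0) ↔ ∀ g, polyEval P (τ g x) = 0 := by
  have hne : ∀ g, τ g x ≠ 0 := fun g h => hx (by
    have := congrArg (τ g⁻¹) h
    simpa using this)
  constructor
  · intro h g
    exact (polyEval_mk_rep_eq_zero_iff hP (hne g)).mp (h _ ⟨g, hne g, rfl⟩)
  · rintro h _ ⟨g, hg, rfl⟩
    exact (polyEval_mk_rep_eq_zero_iff hP hg).mpr (h g)

/-- The cone over the Zariski closure of a projective orbit is the Euclidean closure of the cone
over the orbit. -/
theorem mem_zariskiClosure_projOrbit_iff [FiniteDimensional ℂ V] (hG : IsAlgebraicGroup G)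
    {τ : Representation ℂ G V} (hτ : IsRational τ) {x : V} (hx : x ≠ 0)
    {F : Type*} [NormedAddCommGroup F] [NormedSpace ℂ F] (e : V ≃ₗ[ℂ] F) (p : ℙ ℂ V) :
    p ∈ zariskiClosure (projOrbit τ x) ↔
      e p.rep ∈ closure (Set.range fun a : ℂ × G => e (a.1 • τ a.2 x)) := by
  have : FiniteDimensional ℂ F := e.finiteDimensional
  constructor
  · intro hp
    obtain ⟨E, hE⟩ := hG
    let b := Module.finBasis ℂ V
    choose P hP using fun j => hτ.exists_polynomial (b.coord j) x
    -- The variable `none` is a scalar: the cone over the orbit is the image of the affine variety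
    -- `ℂ × G` under a polynomial map.
    let φ : Fin (Module.finrank ℂ V) → MvPolynomial (Option (Fin n × Fin n)) ℂ := fun j =>
      MvPolynomial.X none * MvPolynomial.rename some (P j)
    have hφ : ∀ (y : Option (Fin n × Fin n) → ℂ) (g : G), (fun ij => y (some ij)) = entries (toMat g) →
        (fun j => (φ j).eval y) = y none • fun j => b.coord j (τ g x) := by
      intro y g hg
      ext j
      simp only [φ, map_mul, MvPolynomial.eval_X, MvPolynomial.eval_rename, Pi.smul_apply,
        smul_eq_mul, hP, ← hg]
      rfl
    have hmem := mem_closure_image_of_forall_eval_eq_zero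
      ((MvPolynomial.rename some) '' E) φ (fun j => b.coord j p.rep) ?_
    · let L : (Fin (Module.finrank ℂ V) → ℂ) →ₗ[ℂ] F := (e : V →ₗ[ℂ] F) ∘ₗ b.equivFun.symm
      have hL : Continuous L := L.continuous_of_finiteDimensional
      have h1 := map_mem_closure hL hmem (t := Set.range fun a : ℂ × G => e (a.1 • τ a.2 x)) ?_
      · convert h1 using 1
        exact congrArg e (b.equivFun.symm_apply_apply p.rep).symm
      · rintro _ ⟨y, hy, rfl⟩
        obtain ⟨g, hg⟩ := (hE (Matrix.of fun i j => y (some (i, j)))).mpr fun Q hQ => by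
          have := hy _ ⟨Q, hQ, rfl⟩
          rw [MvPolynomial.eval_rename] at this
          exact this
        refine ⟨(y none, g), ?_⟩
        have h2 := hφ y g (by rw [hg]; rfl)
        simp only [h2]
        change _ = e (b.equivFun.symm _)
        congr 1
        rw [map_smul]
        congr 1
        exact (b.equivFun.symm_apply_apply _).symm
    · intro Q hQ
      -- On a cone all homogeneous components of `Q` vanish with `Q`, since they are the
      -- coefficients of the polynomial `s ↦ Q (s y)`. Thus homogeneous equations suffice.
      have hcomp : ∀ k g, MvPolynomial.eval (fun j => b.coord j (τ g x))
          (MvPolynomial.homogeneousComponent k Q) = 0 := by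
        intro k g
        by_cases hk : k ∈ Finset.range (Q.totalDegree + 1)
        swap
        · rw [MvPolynomial.homogeneousComponent_eq_zero _ _ (by simpa using hk), map_zero]
        let q : Polynomial ℂ := ∑ k ∈ Finset.range (Q.totalDegree + 1), Polynomial.monomial k
          (MvPolynomial.eval (fun j => b.coord j (τ g x)) (MvPolynomial.homogeneousComponent k Q))
        have hq : q = 0 := by
          refine Polynomial.funext fun s => ?_
          have h1 := hQ (fun o => o.elim s (entries (toMat g))) (by
            rintro _ ⟨R, hR, rfl⟩
            rw [MvPolynomial.eval_rename]
            exact (hE _).mp ⟨g, rfl⟩ R hR)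
          rw [hφ _ g rfl, eval_smul_eq_sum] at h1
          simp only [q, Polynomial.eval_finsetSum, Polynomial.eval_monomial, Polynomial.eval_zero]
          rw [← h1]
          exact Finset.sum_congr rfl fun k _ => mul_comm _ _
        have h2 := congrArg (fun r => Polynomial.coeff r k) hq
        simpa [q, Polynomial.finsetSum_coeff, Polynomial.coeff_monomial, hk,
          Finset.sum_ite_eq'] using h2
      rw [← one_smul ℂ fun j => b.coord j p.rep, eval_smul_eq_sum]
      refine Finset.sum_eq_zero fun k _ => ?_
      have hhom := MvPolynomial.homogeneousComponent_isHomogeneous k Q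
      have heval : ∀ y : V, polyEval (MvPolynomial.rename b.coord
          (MvPolynomial.homogeneousComponent k Q)) y =
          MvPolynomial.eval (fun j => b.coord j y) (MvPolynomial.homogeneousComponent k Q) :=
        fun y => by rw [polyEval, MvPolynomial.eval_rename]; rfl
      have := hp k _ (hhom.rename_isHomogeneous (f := b.coord))
        ((polyEval_eq_zero_of_mem_projOrbit hx hhom.rename_isHomogeneous).mpr fun g => by
          rw [heval, hcomp])
      rw [heval] at this
      rw [this, mul_zero]
  · intro hp d P hP hS
    rw [polyEval_eq_zero_of_mem_projOrbit hx hP] at hS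
    have hc : Continuous fun y : F => polyEval P (e.symm y) := by
      unfold polyEval
      have : Continuous fun (y : F) (l : Module.Dual ℂ V) => l (e.symm y) :=
        continuous_pi fun l => (l ∘ₗ (e.symm : F →ₗ[ℂ] V)).continuous_of_finiteDimensional
      exact (MvPolynomial.continuous_eval P).comp this
    have h1 := map_mem_closure hc hp (t := {0}) (by
      rintro _ ⟨a, rfl⟩
      simp [polyEval_smul hP, hS])
    simpa using h1

end Closures

/-! ### The numerical criterion for semistability -/

section Criterion

open Filter Topology

theorem representation_apply_ne_zero {H V : Type*} [Group H] [AddCommGroup V] [Module ℂ V]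
    (ρ : Representation ℂ H V) {v : V} (hv : v ≠ 0) (g : H) : ρ g v ≠ 0 := fun h => hv (by
  have := congrArg (ρ g⁻¹) h
  simpa using this)

variable {V W : Type*} [AddCommGroup V] [Module ℂ V] [AddCommGroup W] [Module ℂ W]
  {E F : Type*} [NormedAddCommGroup E] [NormedSpace ℂ E] [NormedAddCommGroup F] [NormedSpace ℂ F]

/-- The inequality is closed and invariant under scaling, so it passes from the orbit to the
Euclidean closure of its cone, which is the cone over the Zariski closure. -/
theorem mul_norm_fst_le_norm_snd_of_mem_zariskiClosure [FiniteDimensional ℂ V]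
    [FiniteDimensional ℂ W] (hG : IsAlgebraicGroup G)
    {ρ : Representation ℂ G V} {σ : Representation ℂ G W} (hρ : IsRational ρ) (hσ : IsRational σ)
    {v : V} {w : W} (hv : v ≠ 0) (eV : V ≃ₗ[ℂ] E) (eW : W ≃ₗ[ℂ] F) {c : ℝ}
    (hc : ∀ g, c * ‖eV (ρ g v)‖ ≤ ‖eW (σ g w)‖) {p : ℙ ℂ (V × W)}
    (hp : p ∈ zariskiClosure (projOrbit (ρ.prod σ) (v, w))) :
    c * ‖eV p.rep.1‖ ≤ ‖eW p.rep.2‖ := by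
  rw [mem_zariskiClosure_projOrbit_iff hG (hρ.prod hσ) (by simp [hv]) (eV.prodCongr eW)] at hp
  have hclosed : IsClosed {y : E × F | c * ‖y.1‖ ≤ ‖y.2‖} :=
    isClosed_le (by fun_prop) (by fun_prop)
  have := closure_minimal (s := Set.range fun a : ℂ × G =>
    (eV.prodCongr eW) (a.1 • (ρ.prod σ) a.2 (v, w))) (by
      rintro _ ⟨⟨s, g⟩, rfl⟩
      simp only [Set.mem_ofPred_eq, LinearEquiv.prodCongr_apply, Prod.smul_fst, Prod.smul_snd,
        Representation.prod_apply_apply, map_smul, norm_smul]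
      rw [mul_left_comm]
      exact mul_le_mul_of_nonneg_left (hc g) (norm_nonneg s)) hclosed hp
  simpa using this

theorem rep_snd_eq_zero_of_mem_zariskiClosure {H : Type*} [Group H]
    {ρ : Representation ℂ H V} {σ : Representation ℂ H W} {v : V} {p : ℙ ℂ (V × W)}
    (hp : p ∈ zariskiClosure (projOrbit (ρ.prod σ) (v, (0 : W)))) : p.rep.2 = 0 := by
  refine (Module.forall_dual_apply_eq_zero_iff ℂ _).mp fun l => ?_
  have h1 := hp 1 (MvPolynomial.X (l ∘ₗ LinearMap.snd ℂ V W)) (MvPolynomial.isHomogeneous_X _ _) (by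
    rintro _ ⟨g, hg, rfl⟩
    rw [polyEval_mk_rep_eq_zero_iff (MvPolynomial.isHomogeneous_X _ _)]
    simp [polyEval])
  simpa [polyEval] using h1

theorem mk_mem_zariskiClosure_of_tendsto [FiniteDimensional ℂ V] (hG : IsAlgebraicGroup G)
    {τ : Representation ℂ G V} (hτ : IsRational τ) {x : V} (hx : x ≠ 0) (e : V ≃ₗ[ℂ] E)
    {y : V} (hy : y ≠ 0) {s : ℕ → ℂ} {g : ℕ → G}
    (h : Tendsto (fun k => e (s k • τ (g k) x)) atTop (𝓝 (e y))) :
    Projectivization.mk ℂ y hy ∈ zariskiClosure (projOrbit τ x) := by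
  rw [mem_zariskiClosure_projOrbit_iff hG hτ hx e]
  obtain ⟨a, ha⟩ := Projectivization.exists_smul_eq_mk_rep ℂ y hy
  refine mem_closure_of_tendsto (f := fun k => e ((a * s k) • τ (g k) x)) (b := atTop) ?_
    (Eventually.of_forall fun k => ⟨(a * s k, g k), rfl⟩)
  rw [← ha, Units.smul_def, map_smul]
  simpa [mul_smul] using h.const_smul (a : ℂ)

/-- If no `c` works, there are `g k` with `‖g k w‖ / ‖g k v‖ → 0`; rescaling `g k v` to norm one
gives a limit `(u, 0)` in both closures. Conversely, a common point has zero second component, and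
then the inequality kills the first. Norms are pulled back along `eV` and `eW` so that the criterion
also applies to tensor products, for which coordinate norms are used. -/
theorem semistable_iff_exists_norm_le [FiniteDimensional ℂ V] [FiniteDimensional ℂ W]
    (hG : IsAlgebraicGroup G)
    {ρ : Representation ℂ G V} {σ : Representation ℂ G W} (hρ : IsRational ρ) (hσ : IsRational σ)
    {v : V} {w : W} (hv : v ≠ 0) (eV : V ≃ₗ[ℂ] E) (eW : W ≃ₗ[ℂ] F) :
    Semistable ρ σ v w ↔ ∃ c : ℝ, 0 < c ∧ ∀ g, c * ‖eV (ρ g v)‖ ≤ ‖eW (σ g w)‖ := by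
  have : FiniteDimensional ℂ E := eV.finiteDimensional
  have : ProperSpace E := FiniteDimensional.proper ℂ E
  constructor
  · intro hss
    by_contra! hcon
    have h1 : ∀ k : ℕ, ∃ g, ‖eW (σ g w)‖ < 1 / ((k : ℝ) + 1) * ‖eV (ρ g v)‖ := fun k =>
      hcon _ (by positivity)
    choose g hg using h1
    have hne : ∀ k, ‖eV (ρ (g k) v)‖ ≠ 0 := fun k => by
      simpa using representation_apply_ne_zero ρ hv (g k)
    let s : ℕ → ℂ := fun k => ((‖eV (ρ (g k) v)‖⁻¹ : ℝ) : ℂ)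
    have hs : ∀ k, ‖s k‖ = ‖eV (ρ (g k) v)‖⁻¹ := fun k => by simp [s]
    obtain ⟨u, hu, θ, hθ, hlim⟩ := (isCompact_sphere (0 : E) 1).tendsto_subseq
      (x := fun k => s k • eV (ρ (g k) v)) fun k => by
        simp [norm_smul, hs, inv_mul_cancel₀ (hne k)]
    have hW : Tendsto (fun k => s k • eW (σ (g k) w)) atTop (𝓝 0) := by
      refine squeeze_zero_norm (fun k => ?_) tendsto_one_div_add_atTop_nhds_zero_nat
      rw [norm_smul, hs, inv_mul_le_iff₀ (lt_of_le_of_ne (norm_nonneg _) (hne k).symm), mul_comm]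
      exact (hg k).le
    have hy : (eV.symm u, (0 : W)) ≠ 0 := by
      have : u ≠ 0 := by rintro rfl; simp at hu
      simpa using this
    have hdisj := Set.disjoint_left.mp hss
    refine @hdisj (Projectivization.mk ℂ (eV.symm u, (0 : W)) hy)
      (mk_mem_zariskiClosure_of_tendsto (s := s ∘ θ) (g := g ∘ θ) hG (hρ.prod hσ) (by simp [hv])
        (eV.prodCongr eW) hy ?_)
      (mk_mem_zariskiClosure_of_tendsto (s := s ∘ θ) (g := g ∘ θ) hG (hρ.prod hσ) (by simp [hv])
        (eV.prodCongr eW) hy ?_)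
    · simpa using hlim.prodMk_nhds (hW.comp hθ.tendsto_atTop)
    · simpa using hlim.prodMk_nhds (tendsto_const_nhds (x := (0 : F)))
  · rintro ⟨c, hc, h⟩
    refine Set.disjoint_left.mpr fun p hp hq => ?_
    have h1 := mul_norm_fst_le_norm_snd_of_mem_zariskiClosure hG hρ hσ hv eV eW h hp
    have h2 := rep_snd_eq_zero_of_mem_zariskiClosure hq
    rw [h2, map_zero, norm_zero] at h1
    have h3 : ‖eV p.rep.1‖ = 0 := le_antisymm (nonpos_of_mul_nonpos_right h1 hc) (norm_nonneg _)
    exact p.rep_nonzero (Prod.ext (by simpa using h3) h2)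

end Criterion

/-! ### The infimum of the energy -/

section Infimum

variable {V W : Type*} [NormedAddCommGroup V] [InnerProductSpace ℂ V]
  [NormedAddCommGroup W] [InnerProductSpace ℂ W]

theorem mabuchi_eq {H : Type*} [Group H] (ρ : Representation ℂ H V) (σ : Representation ℂ H W)
    {v : V} {w : W} (hv : v ≠ 0) (hw : w ≠ 0) (g : H) : mabuchi ρ σ v w g =
      Real.log (‖σ g w‖ ^ 2 / ‖ρ g v‖ ^ 2) + Real.log (‖v‖ ^ 2 / ‖w‖ ^ 2) := by
  have h1 : ‖ρ g v‖ ≠ 0 := norm_ne_zero_iff.mpr (representation_apply_ne_zero ρ hv g)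
  have h2 : ‖σ g w‖ ≠ 0 := norm_ne_zero_iff.mpr (representation_apply_ne_zero σ hw g)
  have h3 : ‖v‖ ≠ 0 := norm_ne_zero_iff.mpr hv
  have h4 : ‖w‖ ≠ 0 := norm_ne_zero_iff.mpr hw
  rw [mabuchi, Real.log_div, Real.log_div, Real.log_div, Real.log_div] <;> first | positivity | ring

theorem semistable_iff_bddBelow [FiniteDimensional ℂ V] [FiniteDimensional ℂ W]
    (hG : IsAlgebraicGroup G)
    {ρ : Representation ℂ G V} {σ : Representation ℂ G W} (hρ : IsRational ρ) (hσ : IsRational σ)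
    {v : V} {w : W} (hv : v ≠ 0) (hw : w ≠ 0) :
    Semistable ρ σ v w ↔ BddBelow (Set.range (mabuchi ρ σ v w)) := by
  rw [semistable_iff_exists_norm_le hG hρ hσ hv (LinearEquiv.refl ℂ V) (LinearEquiv.refl ℂ W)]
  have h1 : ∀ g, 0 < ‖ρ g v‖ := fun g => norm_pos_iff.mpr (representation_apply_ne_zero ρ hv g)
  have h2 : ∀ g, 0 < ‖σ g w‖ := fun g => norm_pos_iff.mpr (representation_apply_ne_zero σ hw g)
  simp only [LinearEquiv.refl_apply]
  constructor
  · rintro ⟨c, hc, h⟩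
    refine ⟨Real.log (c ^ 2) + Real.log (‖v‖ ^ 2 / ‖w‖ ^ 2), ?_⟩
    rintro _ ⟨g, rfl⟩
    rw [mabuchi_eq ρ σ hv hw]
    gcongr
    rw [le_div_iff₀ (by have := h1 g; positivity), ← mul_pow]
    have := h1 g
    exact pow_le_pow_left₀ (by positivity) (h g) 2
  · rintro ⟨b, hb⟩
    refine ⟨Real.exp ((b - Real.log (‖v‖ ^ 2 / ‖w‖ ^ 2)) / 2), Real.exp_pos _, fun g => ?_⟩
    have h3 := hb ⟨g, rfl⟩
    rw [mabuchi_eq ρ σ hv hw] at h3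
    have := h1 g
    have := h2 g
    rw [← le_div_iff₀ (h1 g), ← Real.le_log_iff_exp_le (by positivity)]
    rw [← div_pow, Real.log_pow] at h3
    push_cast at h3
    linarith

/-- The scalars relating `x`, `y` to the chosen representatives cancel between numerator and
denominator. -/
theorem fubiniStudy_mk {x y : V × W} (hx : x ≠ 0) (hy : y ≠ 0) :
    fubiniStudy (Projectivization.mk ℂ x hx) (Projectivization.mk ℂ y hy) =
      Real.arccos (‖inner ℂ (WithLp.toLp 2 x) (WithLp.toLp 2 y)‖ /
        (‖WithLp.toLp 2 x‖ * ‖WithLp.toLp 2 y‖)) := by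
  obtain ⟨a, ha⟩ := Projectivization.exists_smul_eq_mk_rep ℂ x hx
  obtain ⟨b, hb⟩ := Projectivization.exists_smul_eq_mk_rep ℂ y hy
  have ha0 : ‖(a : ℂ)‖ ≠ 0 := by simp
  have hb0 : ‖(b : ℂ)‖ ≠ 0 := by simp
  rw [fubiniStudy, ← ha, ← hb, Units.smul_def, Units.smul_def, WithLp.toLp_smul, WithLp.toLp_smul,
    inner_smul_left, inner_smul_right, norm_smul, norm_smul, norm_mul, norm_mul, RCLike.norm_conj]
  congr 1
  rw [mul_mul_mul_comm, ← mul_assoc, mul_div_mul_left _ _ (mul_ne_zero ha0 hb0)]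

theorem norm_toLp_prod_sq {E F : Type*} [NormedAddCommGroup E] [NormedAddCommGroup F] (a : E)
    (b : F) : ‖WithLp.toLp 2 (a, b)‖ = √(‖a‖ ^ 2 + ‖b‖ ^ 2) := by
  simp [WithLp.prod_norm_eq_of_L2]

theorem arccos_inv_sqrt_one_add_sq {t : ℝ} (ht : 0 ≤ t) :
    Real.arccos (1 / √(1 + t ^ 2)) = Real.arctan t := by
  rw [← Real.cos_arctan, Real.arccos_cos (Real.arctan_nonneg.mpr ht)]
  have := Real.arctan_lt_pi_div_two t
  linarith [Real.pi_pos]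

/-- The distance between the orbit closures is the angle determined by the infimum of the
ratio of the norms. -/
theorem orbitDist_eq_arctan [FiniteDimensional ℂ V] [FiniteDimensional ℂ W]
    (hG : IsAlgebraicGroup G)
    {ρ : Representation ℂ G V} {σ : Representation ℂ G W} (hρ : IsRational ρ) (hσ : IsRational σ)
    {v : V} (w : W) (hv : v ≠ 0) :
    orbitDist ρ σ v w = Real.arctan (⨅ g, ‖σ g w‖ / ‖ρ g v‖) := by
  have h1 : ∀ g, 0 < ‖ρ g v‖ := fun g => norm_pos_iff.mpr (representation_apply_ne_zero ρ hv g)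
  have hbdd : BddBelow (Set.range fun g => ‖σ g w‖ / ‖ρ g v‖) :=
    ⟨0, by rintro _ ⟨g, rfl⟩; positivity⟩
  set m := ⨅ g, ‖σ g w‖ / ‖ρ g v‖ with hm
  have hm0 : 0 ≤ m := Real.iInf_nonneg fun g => by positivity
  have hmle : ∀ g, m * ‖ρ g v‖ ≤ ‖σ g w‖ := fun g => by
    rw [← le_div_iff₀ (h1 g)]; exact ciInf_le hbdd g
  -- A point `(a, b)` of the first closure has `m ‖a‖ ≤ ‖b‖`, and the second closure lies in `V ⊕
  -- 0`; Cauchy–Schwarz bounds the cosine of the angle by `1 / √(1 + m²)`.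
  have hlow : ∀ d ∈ Set.image2 fubiniStudy (zariskiClosure (projOrbit (ρ.prod σ) (v, w)))
      (zariskiClosure (projOrbit (ρ.prod σ) (v, (0 : W)))), Real.arctan m ≤ d := by
    rintro _ ⟨p, hp, q, hq, rfl⟩
    have hp' := mul_norm_fst_le_norm_snd_of_mem_zariskiClosure hG hρ hσ hv
      (LinearEquiv.refl ℂ V) (LinearEquiv.refl ℂ W) hmle hp
    have hq' := rep_snd_eq_zero_of_mem_zariskiClosure hq
    simp only [LinearEquiv.refl_apply] at hp'
    rw [fubiniStudy, ← arccos_inv_sqrt_one_add_sq hm0]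
    refine Real.arccos_le_arccos ?_
    have hp0 := p.rep_nonzero
    have hq0 := q.rep_nonzero
    generalize p.rep = p' at *
    generalize q.rep = q' at *
    obtain ⟨a, b⟩ := p'
    obtain ⟨c, d⟩ := q'
    obtain rfl : d = 0 := hq'
    replace hp' : m * ‖a‖ ≤ ‖b‖ := hp'
    have hc : 0 < ‖c‖ := by
      rw [norm_pos_iff]; rintro rfl; exact hq0 rfl
    have hab : 0 < ‖a‖ ^ 2 + ‖b‖ ^ 2 := by
      by_contra! hle
      have ha : ‖a‖ = 0 := by nlinarith [sq_nonneg ‖a‖, sq_nonneg ‖b‖]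
      have hb : ‖b‖ = 0 := by nlinarith [sq_nonneg ‖a‖, sq_nonneg ‖b‖]
      exact hp0 (by simp [norm_eq_zero.mp ha, norm_eq_zero.mp hb])
    rw [norm_toLp_prod_sq, norm_toLp_prod_sq, WithLp.prod_inner_apply]
    simp only [inner_zero_right, add_zero, norm_zero, ne_eq, OfNat.ofNat_ne_zero, not_false_eq_true,
      zero_pow, Real.sqrt_sq hc.le]
    rw [div_le_div_iff₀ (by positivity) (by positivity), one_mul]
    calc ‖inner ℂ a c‖ * √(1 + m ^ 2) ≤ (‖a‖ * ‖c‖) * √(1 + m ^ 2) := by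
          gcongr; exact norm_inner_le_norm a c
      _ = √(‖a‖ ^ 2 + (m * ‖a‖) ^ 2) * ‖c‖ := by
          rw [show ‖a‖ ^ 2 + (m * ‖a‖) ^ 2 = ‖a‖ ^ 2 * (1 + m ^ 2) by ring,
            Real.sqrt_mul (by positivity), Real.sqrt_sq (norm_nonneg a)]
          ring
      _ ≤ √(‖a‖ ^ 2 + ‖b‖ ^ 2) * ‖c‖ := by gcongr
  have hself : ∀ {τ : Representation ℂ G (V × W)} {x : V × W} (_ : x ≠ 0) (g : G) (h : τ g x ≠ 0),
      Projectivization.mk ℂ (τ g x) h ∈ zariskiClosure (projOrbit τ x) := fun _ g h d P _ hS =>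
    hS _ ⟨g, h, rfl⟩
  -- Equality in Cauchy–Schwarz: both points are moved by the same `g`, so their first components
  -- coincide.
  have hmem : ∀ g, Real.arctan (‖σ g w‖ / ‖ρ g v‖) ∈
      Set.image2 fubiniStudy (zariskiClosure (projOrbit (ρ.prod σ) (v, w)))
        (zariskiClosure (projOrbit (ρ.prod σ) (v, (0 : W)))) := by
    intro g
    have hx : (v, w) ≠ 0 := by simp [hv]
    have hy : (v, (0 : W)) ≠ 0 := by simp [hv]
    refine ⟨_, hself hx g (representation_apply_ne_zero _ hx g), _,
      hself hy g (representation_apply_ne_zero _ hy g), ?_⟩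
    rw [fubiniStudy_mk, ← arccos_inv_sqrt_one_add_sq (by positivity)]
    congr 1
    have := h1 g
    simp only [Representation.prod_apply_apply, map_zero]
    rw [norm_toLp_prod_sq, norm_toLp_prod_sq, WithLp.prod_inner_apply]
    simp only [inner_zero_right, add_zero, norm_zero, ne_eq, OfNat.ofNat_ne_zero, not_false_eq_true,
      zero_pow, Real.sqrt_sq this.le, inner_self_eq_norm_sq_to_K]
    rw [show ‖ρ g v‖ ^ 2 + ‖σ g w‖ ^ 2 = ‖ρ g v‖ ^ 2 * (1 + (‖σ g w‖ / ‖ρ g v‖) ^ 2) by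
      field_simp, Real.sqrt_mul (by positivity), Real.sqrt_sq this.le]
    simp
    field_simp
  rw [orbitDist]
  refine le_antisymm ?_ (le_csInf ⟨_, hmem 1⟩ hlow)
  -- The infimum `m` need not be attained, so the bound is proved for each `t > m` and passed to the
  -- limit.
  refine ge_of_tendsto (x := nhdsWithin m (Set.Ioi m)) (f := Real.arctan)
    ((Real.continuous_arctan.tendsto m).mono_left nhdsWithin_le_nhds) ?_
  filter_upwards [self_mem_nhdsWithin] with t ht
  obtain ⟨g, hg⟩ := exists_lt_of_ciInf_lt (f := fun g => ‖σ g w‖ / ‖ρ g v‖) ht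
  exact (csInf_le ⟨_, hlow⟩ (hmem g)).trans (Real.arctan_strictMono.monotone hg.le)

/-- The tangent of the distance is the infimum of the ratios of norms. The map `t ↦ log t² + c` into
`EReal` is monotone for `t ≥ 0` and continuous also at `0`, hence commutes with that infimum,
including the value `⊥`. -/
theorem iInf_mabuchi_eq [FiniteDimensional ℂ V] [FiniteDimensional ℂ W]
    (hG : IsAlgebraicGroup G)
    {ρ : Representation ℂ G V} {σ : Representation ℂ G W} (hρ : IsRational ρ) (hσ : IsRational σ)
    {v : V} {w : W} (hv : v ≠ 0) (hw : w ≠ 0) :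
    (⨅ g : G, ((mabuchi ρ σ v w g : ℝ) : EReal)) =
      ENNReal.log (ENNReal.ofReal (Real.tan (orbitDist ρ σ v w) ^ 2)) +
        ((Real.log (‖v‖ ^ 2 / ‖w‖ ^ 2) : ℝ) : EReal) := by
  have h1 : ∀ g, 0 < ‖ρ g v‖ := fun g => norm_pos_iff.mpr (representation_apply_ne_zero ρ hv g)
  have h2 : ∀ g, 0 < ‖σ g w‖ := fun g => norm_pos_iff.mpr (representation_apply_ne_zero σ hw g)
  rw [orbitDist_eq_arctan hG hρ hσ w hv, Real.tan_arctan]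
  set c := Real.log (‖v‖ ^ 2 / ‖w‖ ^ 2)
  have hlog : ∀ g, ((mabuchi ρ σ v w g : ℝ) : EReal) =
      ENNReal.log (ENNReal.ofReal ((‖σ g w‖ / ‖ρ g v‖) ^ 2)) + (c : EReal) := by
    intro g
    have := h1 g
    have := h2 g
    rw [mabuchi_eq ρ σ hv hw, EReal.coe_add, ← div_pow]
    congr 1
    rw [ENNReal.log_ofReal_of_pos (by positivity)]
  have hbdd : BddBelow (Set.range fun g => ‖σ g w‖ / ‖ρ g v‖) :=
    ⟨0, by rintro _ ⟨g, rfl⟩; positivity⟩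
  set m := ⨅ g, ‖σ g w‖ / ‖ρ g v‖
  have hm0 : 0 ≤ m := Real.iInf_nonneg fun g => by positivity
  have hmono : ∀ s t : ℝ, 0 ≤ s → s ≤ t → ENNReal.log (ENNReal.ofReal (s ^ 2)) + (c : EReal) ≤
      ENNReal.log (ENNReal.ofReal (t ^ 2)) + (c : EReal) := fun s t hs hst => by gcongr
  simp only [hlog]
  refine le_antisymm ?_ (le_iInf fun g => hmono _ _ hm0 (ciInf_le hbdd g))
  have hcont : Continuous fun t : ℝ => ENNReal.log (ENNReal.ofReal (t ^ 2)) + (c : EReal) := by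
    have h3 : Continuous fun t : ℝ => ENNReal.log (ENNReal.ofReal (t ^ 2)) :=
      ENNReal.continuous_log.comp (ENNReal.continuous_ofReal.comp (continuous_pow 2))
    rw [continuous_iff_continuousAt]
    intro t
    exact (EReal.continuousAt_add (Or.inr (EReal.coe_ne_bot c)) (Or.inr (EReal.coe_ne_top c))).comp
      (f := fun t : ℝ => (ENNReal.log (ENNReal.ofReal (t ^ 2)), (c : EReal)))
      (h3.continuousAt.prodMk continuousAt_const)
  refine ge_of_tendsto (x := nhdsWithin m (Set.Ioi m))
    ((hcont.tendsto m).mono_left nhdsWithin_le_nhds) ?_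
  filter_upwards [self_mem_nhdsWithin] with t ht
  obtain ⟨g, hg⟩ := exists_lt_of_ciInf_lt (f := fun g => ‖σ g w‖ / ‖ρ g v‖) ht
  exact (iInf_le _ g).trans (hmono _ _ (by positivity) hg.le)

end Infimum

/-! ### Tensor powers -/

section Tensor

open Module

variable {V W : Type*} [AddCommGroup V] [Module ℂ V] [AddCommGroup W] [Module ℂ W]

theorem isRational_of_basis {ι : Type*} [Finite ι] (b : Basis ι ℂ V) {ρ : Representation ℂ G V}
    (h : ∀ i j, ∃ P : MvPolynomial (Fin n × Fin n) ℂ, ∀ g : G,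
      b.repr (ρ g (b j)) i = MvPolynomial.eval (entries (toMat g)) P) : IsRational ρ := by
  have := Fintype.ofFinite ι
  choose P hP using h
  refine isRational_of_exists_polynomial fun l x =>
    ⟨∑ j, ∑ i, MvPolynomial.C (b.repr x j * l (b i)) * P i j, fun g => ?_⟩
  conv_lhs => rw [← b.sum_repr x, map_sum, map_sum]
  rw [map_sum]
  refine Finset.sum_congr rfl fun j _ => ?_
  rw [map_smul, map_smul, ← b.sum_repr (ρ g (b j)), map_sum, map_sum, Finset.smul_sum]
  refine Finset.sum_congr rfl fun i _ => ?_
  simp only [map_smul, smul_eq_mul, map_mul, MvPolynomial.eval_C, hP]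
  ring

theorem tensorPow_apply_tprod {H : Type*} [Group H] (ρ : Representation ℂ H V) (m : ℕ) (g : H)
    (x : Fin m → V) : tensorPow ρ m g (PiTensorProduct.tprod ℂ x) =
      PiTensorProduct.tprod ℂ fun k => ρ g (x k) := by
  change PiTensorProduct.map (fun _ => ρ g) (PiTensorProduct.tprod ℂ x) = _
  rw [PiTensorProduct.map_tprod]

theorem tensorPow_apply_vecPow {H : Type*} [Group H] (ρ : Representation ℂ H V) (m : ℕ) (g : H)
    (x : V) : tensorPow ρ m g (vecPow x m) = vecPow (ρ g x) m :=
  tensorPow_apply_tprod ρ m g _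

theorem IsRational.tensorPow [FiniteDimensional ℂ V] {ρ : Representation ℂ G V}
    (hρ : IsRational ρ) (m : ℕ) : IsRational (tensorPow ρ m) := by
  let b := finBasis ℂ V
  refine isRational_of_basis (Basis.piTensorProduct fun _ : Fin m => b) fun i j => ?_
  choose P hP using fun k : Fin m => hρ.exists_polynomial (b.coord (i k)) (b (j k))
  refine ⟨∏ k, P k, fun g => ?_⟩
  rw [Basis.piTensorProduct_apply, tensorPow_apply_tprod, Basis.piTensorProduct_repr_tprod_apply,
    map_prod]
  exact Finset.prod_congr rfl fun k _ => hP k g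

theorem IsRational.tprod [FiniteDimensional ℂ V] [FiniteDimensional ℂ W]
    {ρ : Representation ℂ G V} {σ : Representation ℂ G W} (hρ : IsRational ρ)
    (hσ : IsRational σ) : IsRational (ρ.tprod σ) := by
  let b := finBasis ℂ V
  let b' := finBasis ℂ W
  refine isRational_of_basis (b.tensorProduct b') fun ⟨i, i'⟩ ⟨j, j'⟩ => ?_
  obtain ⟨P, hP⟩ := hρ.exists_polynomial (b.coord i) (b j)
  obtain ⟨Q, hQ⟩ := hσ.exists_polynomial (b'.coord i') (b' j')
  refine ⟨P * Q, fun g => ?_⟩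
  rw [map_mul, ← hP, ← hQ]
  simp [Basis.tensorProduct_repr_tmul_apply, mul_comm]

theorem stdBasis_repr_apply (A : Matrix (Fin n) (Fin n) ℂ) (i : Fin n × Fin n) :
    (Matrix.stdBasis ℂ (Fin n) (Fin n)).repr A i = A i.1 i.2 := by
  simp [Matrix.stdBasis]

theorem isRational_leftRegular : IsRational (leftRegular G) := by
  refine isRational_of_basis (Matrix.stdBasis ℂ (Fin n) (Fin n)) fun i j =>
    ⟨if i.2 = j.2 then MvPolynomial.X (i.1, j.1) else 0, fun g => ?_⟩
  change (Matrix.stdBasis ℂ (Fin n) (Fin n)).repr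
    (toMat g * Matrix.stdBasis ℂ (Fin n) (Fin n) (j.1, j.2)) i = _
  rw [stdBasis_repr_apply, Matrix.stdBasis_eq_single]
  by_cases h : i.2 = j.2
  · rw [if_pos h, h, Matrix.mul_single_apply_same, mul_one, MvPolynomial.eval_X]
    rfl
  · rw [if_neg h, Matrix.mul_single_apply_of_ne _ _ _ _ _ h, map_zero]

theorem leftRegular_apply_one (g : G) : leftRegular G g 1 = toMat g := by
  change toMat g * 1 = toMat g
  rw [mul_one]

/-- The coordinates of a tensor power are products of coordinates of `x`, and the largest product
repeats the largest coordinate. Sup norms give exact multiplicativity. -/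
theorem norm_equivFun_vecPow {ι : Type*} [Fintype ι] (b : Basis ι ℂ V) (x : V) (m : ℕ) :
    ‖(Basis.piTensorProduct fun _ : Fin m => b).equivFun (vecPow x m)‖ = ‖b.equivFun x‖ ^ m := by
  have hcoord : ∀ f : Fin m → ι, (Basis.piTensorProduct fun _ : Fin m => b).equivFun (vecPow x m) f =
      ∏ k, b.equivFun x (f k) := fun f => by
    simp [vecPow, Basis.piTensorProduct_repr_tprod_apply]
  refine le_antisymm ((pi_norm_le_iff_of_nonneg (by positivity)).mpr fun f => ?_) ?_
  · rw [hcoord, norm_prod]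
    refine (Finset.prod_le_prod (fun _ _ => norm_nonneg _)
      fun k _ => norm_le_pi_norm (b.equivFun x) (f k)).trans ?_
    simp
  -- Without coordinates there is no largest one; for `m = 0` the empty product still gives norm
  -- `1`.
  · rcases isEmpty_or_nonempty ι with h | h
    · rcases Nat.eq_zero_or_pos m with rfl | hm
      · have h1 := norm_le_pi_norm
          ((Basis.piTensorProduct fun _ : Fin 0 => b).equivFun (vecPow x 0)) default
        rw [hcoord] at h1
        simpa using h1
      · have : b.equivFun x = 0 := Subsingleton.elim _ _
        rw [this, norm_zero, zero_pow hm.ne']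
        exact norm_nonneg _
    · obtain ⟨i, hi⟩ : ∃ i, ‖b.equivFun x‖ = ‖b.equivFun x i‖ := by
        obtain ⟨i, -, hi⟩ := Finset.exists_mem_eq_sup' (s := Finset.univ)
          (Finset.univ_nonempty (α := ι)) fun i => ‖b.equivFun x i‖₊
        refine ⟨i, ?_⟩
        rw [Pi.norm_def, ← Finset.sup'_eq_sup Finset.univ_nonempty, hi]
        rfl
      have h1 := norm_le_pi_norm
        ((Basis.piTensorProduct fun _ : Fin m => b).equivFun (vecPow x m)) fun _ => i
      rw [hcoord] at h1
      rw [hi]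
      simpa using h1

theorem pi_norm_mul_le {α : Type*} [Fintype α] {u : α → ℂ} {v r : ℝ} (hv : 0 ≤ v) (hr : 0 ≤ r)
    (h : ∀ i, ‖u i‖ * v ≤ r) : ‖u‖ * v ≤ r := by
  rcases hv.eq_or_lt with rfl | hv
  · simpa
  · rw [← le_div_iff₀ hv, pi_norm_le_iff_of_nonneg (by positivity)]
    exact fun i => (le_div_iff₀ hv).mpr (h i)

theorem norm_equivFun_tmul {ι κ : Type*} [Fintype ι] [Fintype κ] (b : Basis ι ℂ V)
    (b' : Basis κ ℂ W) (x : V) (y : W) :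
    ‖(b.tensorProduct b').equivFun (x ⊗ₜ y)‖ = ‖b.equivFun x‖ * ‖b'.equivFun y‖ := by
  have hcoord : ∀ i j, (b.tensorProduct b').equivFun (x ⊗ₜ y) (i, j) =
      b.equivFun x i * b'.equivFun y j := fun i j => by
    simp [Basis.tensorProduct_repr_tmul_apply, mul_comm]
  refine le_antisymm ((pi_norm_le_iff_of_nonneg (by positivity)).mpr fun ⟨i, j⟩ => ?_) ?_
  · rw [hcoord, norm_mul]
    exact mul_le_mul (norm_le_pi_norm _ _) (norm_le_pi_norm _ _) (norm_nonneg _) (norm_nonneg _)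
  · refine pi_norm_mul_le (norm_nonneg _) (norm_nonneg _) fun i => ?_
    rw [mul_comm]
    refine pi_norm_mul_le (norm_nonneg _) (norm_nonneg _) fun j => ?_
    have := norm_le_pi_norm ((b.tensorProduct b').equivFun (x ⊗ₜ y)) (i, j)
    rwa [hcoord, norm_mul, mul_comm] at this

end Tensor

/-! ### Stability and properness -/

section Proper

open Module

theorem exists_norm_equivFun_bounds {V ι : Type*} [NormedAddCommGroup V] [NormedSpace ℂ V]
    [Fintype ι] (b : Basis ι ℂ V) : ∃ c C : ℝ, 0 < c ∧ 0 < C ∧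
      ∀ x, c * ‖x‖ ≤ ‖b.equivFun x‖ ∧ ‖b.equivFun x‖ ≤ C * ‖x‖ := by
  have : FiniteDimensional ℂ V := b.finiteDimensional_of_finite
  let e := b.equivFun.toContinuousLinearEquiv
  refine ⟨(‖(e.symm : (ι → ℂ) →L[ℂ] V)‖ + 1)⁻¹, ‖(e : V →L[ℂ] (ι → ℂ))‖ + 1, by positivity,
    by positivity, fun x => ⟨?_, ?_⟩⟩
  · rw [inv_mul_le_iff₀ (by positivity)]
    have h1 := (e.symm : (ι → ℂ) →L[ℂ] V).le_opNorm (e x)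
    have h2 : (e.symm : (ι → ℂ) →L[ℂ] V) (e x) = x := e.symm_apply_apply x
    rw [h2] at h1
    refine h1.trans ?_
    change _ * ‖e x‖ ≤ _ * ‖e x‖
    gcongr
    linarith
  · refine ((e : V →L[ℂ] (ι → ℂ)).le_opNorm x).trans ?_
    gcongr
    linarith

theorem norm_toMat_apply_le (g : G) (i j : Fin n) : ‖toMat g i j‖ ≤ √(matNormSq g) := by
  refine Real.le_sqrt_of_sq_le ?_
  refine le_trans ?_ (Finset.single_le_sum (f := fun i => ∑ j, ‖toMat g i j‖ ^ 2)
    (fun _ _ => by positivity) (Finset.mem_univ i))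
  exact Finset.single_le_sum (f := fun j => ‖toMat g i j‖ ^ 2) (fun _ _ => by positivity)
    (Finset.mem_univ j)

theorem exists_matNormSq_bounds (hn : 0 < n) : ∃ c C : ℝ, 0 < c ∧ 0 < C ∧ ∀ g : G,
    c * √(matNormSq g) ≤ ‖(Matrix.stdBasis ℂ (Fin n) (Fin n)).equivFun (toMat g)‖ ∧
    ‖(Matrix.stdBasis ℂ (Fin n) (Fin n)).equivFun (toMat g)‖ ≤ C * √(matNormSq g) := by
  have hn' : (0 : ℝ) < n := by exact_mod_cast hn
  refine ⟨(n : ℝ)⁻¹, 1, by positivity, one_pos, fun g => ⟨?_, ?_⟩⟩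
  · rw [inv_mul_le_iff₀ hn']
    refine Real.sqrt_le_iff.mpr ⟨by positivity, ?_⟩
    have h : ∀ i j, ‖toMat g i j‖ ^ 2 ≤
        ‖(Matrix.stdBasis ℂ (Fin n) (Fin n)).equivFun (toMat g)‖ ^ 2 := fun i j => by
      gcongr
      have := norm_le_pi_norm ((Matrix.stdBasis ℂ (Fin n) (Fin n)).equivFun (toMat g)) (i, j)
      rwa [Basis.equivFun_apply, stdBasis_repr_apply] at this
    refine (Finset.sum_le_sum fun i _ => Finset.sum_le_sum fun j _ => h i j).trans (le_of_eq ?_)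
    simp
    ring
  · rw [one_mul, pi_norm_le_iff_of_nonneg (Real.sqrt_nonneg _)]
    intro i
    rw [Basis.equivFun_apply, stdBasis_repr_apply]
    exact norm_toMat_apply_le g i.1 i.2

theorem det_toMat (g : G) : (toMat g).det = 1 := (g : Matrix.SpecialLinearGroup (Fin n) ℂ).2

theorem matNormSq_pos (hn : 0 < n) (g : G) : 0 < matNormSq g := by
  by_contra! hle
  have h0 : toMat g = 0 := by
    ext i j
    have := norm_toMat_apply_le g i j
    rw [Real.sqrt_eq_zero_of_nonpos hle] at this
    simpa using this
  have h1 := det_toMat g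
  have : Nonempty (Fin n) := ⟨⟨0, hn⟩⟩
  rw [h0, Matrix.det_zero] at h1
  exact zero_ne_one h1

variable {V W : Type*} [NormedAddCommGroup V] [InnerProductSpace ℂ V] [FiniteDimensional ℂ V]
  [NormedAddCommGroup W] [InnerProductSpace ℂ W] [FiniteDimensional ℂ W]

/-- The criterion for semistability is applied in product bases, where the norms of the tensors
factor. Replacing sup norms by the given ones changes only the constant `c`. -/
theorem stable_iff_exists_norm_le (hn : 0 < n) (hG : IsAlgebraicGroup G)
    {ρ : Representation ℂ G V} {σ : Representation ℂ G W} (hρ : IsRational ρ) (hσ : IsRational σ)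
    {v : V} {w : W} (hv : v ≠ 0) : Stable ρ σ v w ↔ ∃ m : ℕ, 0 < m ∧ ∃ c : ℝ, 0 < c ∧ ∀ g,
      c * (√(matNormSq g) ^ degree ρ * ‖ρ g v‖ ^ m) ≤ ‖σ g w‖ ^ (m + 1) := by
  refine exists_congr fun m => and_congr_right fun _ => ?_
  let b := finBasis ℂ V
  let b' := finBasis ℂ W
  have hne : vecPow (1 : Matrix (Fin n) (Fin n) ℂ) (degree ρ) ⊗ₜ[ℂ] vecPow v m ≠ 0 := by
    intro h0
    have : Nonempty (Fin n) := ⟨⟨0, hn⟩⟩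
    have h1 := norm_equivFun_tmul
      (Basis.piTensorProduct fun _ => Matrix.stdBasis ℂ (Fin n) (Fin n))
      (Basis.piTensorProduct fun _ => b) (vecPow (1 : Matrix (Fin n) (Fin n) ℂ) (degree ρ))
      (vecPow v m)
    rw [h0, map_zero, norm_zero, norm_equivFun_vecPow, norm_equivFun_vecPow] at h1
    have h2 : ‖b.equivFun v‖ ≠ 0 := by
      rw [norm_ne_zero_iff, (map_ne_zero_iff _ b.equivFun.injective)]; exact hv
    have h3 : ‖(Matrix.stdBasis ℂ (Fin n) (Fin n)).equivFun 1‖ ≠ 0 := by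
      rw [norm_ne_zero_iff, (map_ne_zero_iff _ (LinearEquiv.injective _))]; exact one_ne_zero
    exact mul_ne_zero (pow_ne_zero _ h3) (pow_ne_zero _ h2) h1.symm
  rw [semistable_iff_exists_norm_le hG ((isRational_leftRegular.tensorPow _).tprod (hρ.tensorPow m))
    (hσ.tensorPow (m + 1)) hne
    ((Basis.piTensorProduct fun _ => Matrix.stdBasis ℂ (Fin n) (Fin n)).tensorProduct
      (Basis.piTensorProduct fun _ => b)).equivFun (Basis.piTensorProduct fun _ => b').equivFun]
  simp only [Representation.tprod_apply, TensorProduct.map_tmul, tensorPow_apply_vecPow,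
    leftRegular_apply_one, norm_equivFun_tmul, norm_equivFun_vecPow]
  obtain ⟨c₀, C₀, hc₀, hC₀, h₀⟩ := exists_matNormSq_bounds (G := G) hn
  obtain ⟨c₁, C₁, hc₁, hC₁, h₁⟩ := exists_norm_equivFun_bounds b
  obtain ⟨c₂, C₂, hc₂, hC₂, h₂⟩ := exists_norm_equivFun_bounds b'
  constructor
  · rintro ⟨c, hc, h⟩
    refine ⟨c * (c₀ ^ degree ρ * c₁ ^ m) / C₂ ^ (m + 1), by positivity, fun g => ?_⟩
    rw [div_mul_eq_mul_div, div_le_iff₀ (by positivity)]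
    calc _ = c * ((c₀ * √(matNormSq g)) ^ degree ρ * (c₁ * ‖ρ g v‖) ^ m) := by ring
      _ ≤ _ := by gcongr; exacts [(h₀ g).1, (h₁ _).1]
      _ ≤ _ := h g
      _ ≤ (C₂ * ‖σ g w‖) ^ (m + 1) := by gcongr; exact (h₂ _).2
      _ = _ := by ring
  · rintro ⟨c, hc, h⟩
    refine ⟨c * c₂ ^ (m + 1) / (C₀ ^ degree ρ * C₁ ^ m), by positivity, fun g => ?_⟩
    rw [div_mul_eq_mul_div, div_le_iff₀ (by positivity)]
    calc _ ≤ c * c₂ ^ (m + 1) * ((C₀ * √(matNormSq g)) ^ degree ρ * (C₁ * ‖ρ g v‖) ^ m) := by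
          gcongr; exacts [(h₀ g).2, (h₁ _).2]
      _ = c₂ ^ (m + 1) * (C₀ ^ degree ρ * C₁ ^ m) *
          (c * (√(matNormSq g) ^ degree ρ * ‖ρ g v‖ ^ m)) := by ring
      _ ≤ c₂ ^ (m + 1) * (C₀ ^ degree ρ * C₁ ^ m) * ‖σ g w‖ ^ (m + 1) := by gcongr; exact h g
      _ = (c₂ * ‖σ g w‖) ^ (m + 1) * (C₀ ^ degree ρ * C₁ ^ m) := by ring
      _ ≤ _ := by gcongr; exact (h₂ _).1

/-- In logarithms, the inequality for `m` reads `(m + 1) ν ≥ J_v + const`, that is, properness with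
`ε = 1 / (m + 1)`. A lower bound of `J_v` allows a given `ε` to be decreased to this form. -/
theorem stable_iff_mabuchiProper (hn : 0 < n) (hG : IsAlgebraicGroup G)
    {ρ : Representation ℂ G V} {σ : Representation ℂ G W} (hρ : IsRational ρ) (hσ : IsRational σ)
    {v : V} {w : W} (hv : v ≠ 0) (hw : w ≠ 0) (hJ : BddBelow (Set.range (aubin ρ v))) :
    Stable ρ σ v w ↔ MabuchiProper ρ σ v w := by
  rw [stable_iff_exists_norm_le hn hG hρ hσ hv]
  have h1 : ∀ g, 0 < ‖ρ g v‖ := fun g => norm_pos_iff.mpr (representation_apply_ne_zero ρ hv g)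
  have h2 : ∀ g, 0 < ‖σ g w‖ := fun g => norm_pos_iff.mpr (representation_apply_ne_zero σ hw g)
  have h3 : ∀ g : G, 0 < matNormSq g := matNormSq_pos hn
  have hn' : (0 : ℝ) < n := by exact_mod_cast hn
  have hv' : 0 < ‖v‖ := norm_pos_iff.mpr hv
  have hw' : 0 < ‖w‖ := norm_pos_iff.mpr hw
  have hν : ∀ g, mabuchi ρ σ v w g = 2 * Real.log ‖σ g w‖ - 2 * Real.log ‖ρ g v‖ +
      (2 * Real.log ‖v‖ - 2 * Real.log ‖w‖) := fun g => by
    rw [mabuchi_eq ρ σ hv hw, ← div_pow, ← div_pow, Real.log_pow, Real.log_pow,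
      Real.log_div (h2 g).ne' (h1 g).ne', Real.log_div hv'.ne' hw'.ne']
    push_cast; ring
  have hA : ∀ g, aubin ρ v g = degree ρ * Real.log (matNormSq g) - 2 * Real.log ‖ρ g v‖ +
      (2 * Real.log ‖v‖ - degree ρ * Real.log n) := fun g => by
    rw [aubin, ← div_pow, Real.log_pow, Real.log_div (h3 g).ne' hn'.ne',
      Real.log_div (h1 g).ne' hv'.ne']
    push_cast; ring
  have hle : ∀ (m : ℕ) (c : ℝ) (g : G), 0 < c →
      (c * (√(matNormSq g) ^ degree ρ * ‖ρ g v‖ ^ m) ≤ ‖σ g w‖ ^ (m + 1) ↔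
        Real.log c + (degree ρ * (Real.log (matNormSq g) / 2) + m * Real.log ‖ρ g v‖) ≤
          (m + 1) * Real.log ‖σ g w‖) := fun m c g hc => by
    have := h1 g
    have := h2 g
    have := h3 g
    rw [← Real.log_le_log_iff (by positivity) (by positivity), Real.log_mul (by positivity)
      (by positivity), Real.log_mul (by positivity) (by positivity), Real.log_pow, Real.log_pow,
      Real.log_pow, Real.log_sqrt (h3 g).le]
    push_cast; rfl
  obtain ⟨B, hB⟩ := hJ
  constructor
  · rintro ⟨m, hm, c, hc, h⟩
    have hm1 : (0 : ℝ) < m + 1 := by positivity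
    set K := (2 * Real.log c + (m + 1) * (2 * Real.log ‖v‖ - 2 * Real.log ‖w‖) -
      (2 * Real.log ‖v‖ - degree ρ * Real.log n)) with hK
    refine ⟨1 / (m + 1), K / (m + 1), by positivity, fun g => ?_⟩
    have h4 := (hle m c g hc).mp (h g)
    rw [ge_iff_le, div_mul_eq_mul_div, one_mul, ← add_div, div_le_iff₀ hm1, hν, hA, hK]
    nlinarith
  · rintro ⟨ε, b, hε, h⟩
    -- With `m > 1 / ε` the surplus coefficient `ε (m + 1) - 1` is nonnegative, so the surplus
    -- multiple of `J_v` may be replaced by its lower bound `B`.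
    obtain ⟨m, hm⟩ := exists_nat_gt (1 / ε)
    have hm0 : (0 : ℝ) < m := lt_trans (by positivity) hm
    have hm1 : (0 : ℝ) < m + 1 := by positivity
    have hεm : 1 ≤ ε * (m + 1) := by
      rw [div_lt_iff₀ hε] at hm; nlinarith
    set K := ((ε * (m + 1) - 1) * B + b * (m + 1) + (2 * Real.log ‖v‖ - degree ρ * Real.log n) -
      (m + 1) * (2 * Real.log ‖v‖ - 2 * Real.log ‖w‖)) with hK
    refine ⟨m, by exact_mod_cast hm0, Real.exp (K / 2), Real.exp_pos _, fun g => ?_⟩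
    rw [hle m _ g (Real.exp_pos _), Real.log_exp]
    have h4 := h g
    have h5 := hB ⟨g, rfl⟩
    have h6 : (m + 1) * mabuchi ρ σ v w g ≥ aubin ρ v g + (ε * (m + 1) - 1) * B + b * (m + 1) := by
      have h7 := mul_le_mul_of_nonneg_left h5 (sub_nonneg.mpr hεm)
      have h8 := mul_le_mul_of_nonneg_right h4 hm1.le
      nlinarith
    rw [hν, hA] at h6
    rw [hK]
    nlinarith

end Proper

/-! ### Independence of characters -/

section Characters

/-- Dedekind's independence of characters, tested against every linear functional on `V`. -/
theorem finsupp_eq_of_sum_monoidHom_smul_eq {M V : Type*} [Monoid M] [AddCommGroup V] [Module ℂ V]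
    {F F' : (M →* ℂ) →₀ V}
    (h : ∀ t, (F.sum fun χ x => χ t • x) = F'.sum fun χ x => χ t • x) : F = F' := by
  ext χ
  rw [← sub_eq_zero]
  refine (Module.forall_dual_apply_eq_zero_iff ℂ _).mp fun l => ?_
  rw [map_sub, sub_eq_zero]
  have hli := linearIndependent_monoidHom M ℂ
  have key : F.mapRange l (map_zero l) = F'.mapRange l (map_zero l) := by
    refine hli ?_
    ext t
    have := congrArg l (h t)
    rw [map_finsuppSum, map_finsuppSum] at this
    rw [Finsupp.linearCombination_apply, Finsupp.linearCombination_apply,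
      Finsupp.sum_mapRange_index (by simp), Finsupp.sum_mapRange_index (by simp)]
    simpa [Finsupp.sum, Finset.sum_apply, mul_comm] using this
  simpa using DFunLike.congr_fun key χ

/-- The algebra of functions on a monoid spanned by the characters. -/
def characterAlgebra (M : Type*) [Monoid M] : Subalgebra ℂ (M → ℂ) :=
  Algebra.adjoin ℂ (Set.range fun χ : M →* ℂ => (χ : M → ℂ))

theorem monoidHom_mem_characterAlgebra {M : Type*} [Monoid M] (χ : M →* ℂ) :
    (χ : M → ℂ) ∈ characterAlgebra M :=
  Algebra.subset_adjoin ⟨χ, rfl⟩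

/-- Characters are closed under products, so the algebra they generate is already their linear span.
-/
theorem exists_finsupp_of_mem_characterAlgebra {M : Type*} [Monoid M] {f : M → ℂ}
    (hf : f ∈ characterAlgebra M) : ∃ a : (M →* ℂ) →₀ ℂ, ∀ t, f t = a.sum fun χ c => c * χ t := by
  have h1 : (characterAlgebra M).toSubmodule =
      Submodule.span ℂ (Set.range fun χ : M →* ℂ => (χ : M → ℂ)) := by
    rw [characterAlgebra, Algebra.adjoin_eq_span]
    congr 1
    exact congrArg SetLike.coe (Submonoid.closure_eq (MonoidHom.mrange (MonoidHom.coeFn M ℂ)))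
  rw [← Subalgebra.mem_toSubmodule, h1, Finsupp.mem_span_range_iff_exists_finsupp] at hf
  obtain ⟨a, ha⟩ := hf
  refine ⟨a, fun t => ?_⟩
  rw [← ha]
  simp [Finsupp.sum, Finset.sum_apply]

theorem eval_mem_of_forall_mem {α ι : Type*} {A : Subalgebra ℂ (α → ℂ)} {x : α → ι → ℂ}
    (hx : ∀ i, (fun t => x t i) ∈ A) (P : MvPolynomial ι ℂ) :
    (fun t => MvPolynomial.eval (x t) P) ∈ A := by
  induction P using MvPolynomial.induction_on with
  | C c =>
    simp only [MvPolynomial.eval_C]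
    exact A.algebraMap_mem c
  | add P Q hP hQ =>
    simp only [map_add]
    exact A.add_mem hP hQ
  | mul_X P i hP =>
    simp only [map_mul, MvPolynomial.eval_X]
    exact A.mul_mem hP (hx i)

end Characters

/-! ### Weights of tori -/

section Weights

open Module

theorem toMat_inv (g : G) : toMat g⁻¹ = (toMat g).adjugate := by
  simp [toMat, Matrix.SpecialLinearGroup.coe_inv]

theorem exists_polynomial_inv (P : MvPolynomial (Fin n × Fin n) ℂ) :
    ∃ Q : MvPolynomial (Fin n × Fin n) ℂ, ∀ g : G,
      MvPolynomial.eval (entries (toMat g⁻¹)) P = MvPolynomial.eval (entries (toMat g)) Q := by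
  let f : Fin n × Fin n → MvPolynomial (Fin n × Fin n) ℂ := fun ij =>
    (Matrix.mvPolynomialX (Fin n) (Fin n) ℂ).adjugate ij.1 ij.2
  refine ⟨MvPolynomial.bind₁ f P, fun g => ?_⟩
  have h1 : ∀ ij, MvPolynomial.eval (entries (toMat g)) (f ij) = entries (toMat g⁻¹) ij := by
    intro ij
    have h2 := RingHom.map_adjugate (MvPolynomial.eval (entries (toMat g)))
      (Matrix.mvPolynomialX (Fin n) (Fin n) ℂ)
    have h3 : (MvPolynomial.eval (entries (toMat g))).mapMatrix
        (Matrix.mvPolynomialX (Fin n) (Fin n) ℂ) = toMat g := by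
      ext i j
      simp [Matrix.mvPolynomialX, entries]
    rw [h3, ← toMat_inv] at h2
    exact congrFun (congrFun h2 ij.1) ij.2
  have h4 : (MvPolynomial.eval (entries (toMat g))).comp
      (MvPolynomial.bind₁ f : MvPolynomial (Fin n × Fin n) ℂ →+* _) =
      MvPolynomial.eval (entries (toMat g⁻¹)) := by
    ext ij
    · simp
    · simp [h1]
  exact (DFunLike.congr_fun h4 P).symm

variable {V : Type*} [AddCommGroup V] [Module ℂ V]

/-- The character is a matrix coefficient, for a functional equal to `1` at `x`. Its inverse is
regular too, since inversion in `SL` is the adjugate. -/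
theorem mem_characterGroup_of_apply_eq_smul {ρ : Representation ℂ G V} (hρ : IsRational ρ)
    {T : Subgroup G} (χ : T →* ℂˣ) {x : V} (hx : x ≠ 0)
    (h : ∀ t : T, ρ (t : G) x = (χ t : ℂ) • x) : χ ∈ characterGroup T := by
  obtain ⟨l, hl⟩ : ∃ l : Module.Dual ℂ V, l x = 1 := by
    obtain ⟨l, hl⟩ : ∃ l : Module.Dual ℂ V, l x ≠ 0 := by
      by_contra! hcon
      exact hx ((Module.forall_dual_apply_eq_zero_iff ℂ x).mp hcon)
    exact ⟨(l x)⁻¹ • l, by simp [hl]⟩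
  obtain ⟨P, hP⟩ := hρ.exists_polynomial l x
  obtain ⟨Q, hQ⟩ := exists_polynomial_inv (G := G) P
  have key : ∀ t : T, (χ t : ℂ) = MvPolynomial.eval (entries (toMat (t : G))) P := fun t => by
    rw [← hP, h, map_smul, hl, smul_eq_mul, mul_one]
  refine ⟨⟨P, key⟩, ⟨Q, fun t => ?_⟩⟩
  have := key t⁻¹
  rw [map_inv, InvMemClass.coe_inv, hQ] at this
  exact this

theorem charEval_injective {T : Subgroup G} {a b : CharLattice T}
    (h : ∀ t, charEval a t = charEval b t) : a = b :=
  Additive.toMul.injective (Subtype.ext (MonoidHom.ext fun t => Units.ext (h t)))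

theorem charEval_add {T : Subgroup G} (a b : CharLattice T) (t : T) :
    charEval (a + b) t = charEval a t * charEval b t := rfl

theorem charEval_zero {T : Subgroup G} (t : T) : charEval (0 : CharLattice T) t = 1 := rfl

theorem charEval_ne_zero {T : Subgroup G} (a : CharLattice T) (t : T) : charEval a t ≠ 0 :=
  Units.ne_zero _

/-- A character as a multiplicative map to `ℂ`. -/
def charHom {T : Subgroup G} (a : CharLattice T) : T →* ℂ :=
  (Units.coeHom ℂ).comp ((Additive.toMul a : characterGroup T) : T →* ℂˣ)

theorem linearIndependent_charEval (T : Subgroup G) :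
    LinearIndependent ℂ (fun a : CharLattice T => (charEval a : T → ℂ)) :=
  (linearIndependent_monoidHom T ℂ).comp charHom fun _ _ h =>
    charEval_injective fun t => DFunLike.congr_fun h t

theorem charEval_sum {T : Subgroup G} {ι : Type*} (s : Finset ι) (f : ι → CharLattice T) (t : T) :
    charEval (∑ i ∈ s, f i) t = ∏ i ∈ s, charEval (f i) t := by
  classical
  induction s using Finset.induction_on with
  | empty => simp [charEval_zero]
  | insert i s hi ih => rw [Finset.sum_insert hi, Finset.prod_insert hi, charEval_add, ih]

theorem IsWeightVector.zero (ρ : Representation ℂ G V) (T : Subgroup G) (a : CharLattice T) :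
    IsWeightVector ρ T a 0 := fun t => by simp

theorem IsWeightVector.add {ρ : Representation ℂ G V} {T : Subgroup G} {a : CharLattice T}
    {x y : V} (hx : IsWeightVector ρ T a x) (hy : IsWeightVector ρ T a y) :
    IsWeightVector ρ T a (x + y) := fun t => by rw [map_add, hx t, hy t, smul_add]

/-- Every vector of a rational module is a sum of weight vectors of a torus. -/
theorem exists_weight_decomposition [FiniteDimensional ℂ V] {ρ : Representation ℂ G V}
    (hρ : IsRational ρ) {T : Subgroup G} (hT : IsTorus T) (v : V) :
    ∃ f : CharLattice T →₀ V, (∀ b, IsWeightVector ρ T b (f b)) ∧ (f.sum fun _ x => x) = v := by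
  classical
  obtain ⟨r, φ, hinj, rfl, hφ⟩ := hT
  have hent : ∀ ij : Fin n × Fin n, (fun t => entries (toMat (φ t)) ij) ∈
      characterAlgebra (Fin r → ℂˣ) := by
    intro ij
    obtain ⟨P, hP⟩ := hφ ij.1 ij.2
    have : (fun t => entries (toMat (φ t)) ij) = fun t : Fin r → ℂˣ =>
        MvPolynomial.eval (Sum.elim (fun k => (t k : ℂ)) (fun k => ((t k)⁻¹ : ℂ))) P :=
      funext fun t => hP t
    rw [this]
    refine eval_mem_of_forall_mem (fun k => ?_) P
    rcases k with k | k
    · exact monoidHom_mem_characterAlgebra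
        ((Units.coeHom ℂ).comp (Pi.evalMonoidHom (fun _ : Fin r => ℂˣ) k))
    · have := monoidHom_mem_characterAlgebra
        ((Units.coeHom ℂ).comp (Pi.evalMonoidHom (fun _ : Fin r => ℂˣ) k)⁻¹)
      convert this using 1
      ext t
      simp
  let b := finBasis ℂ V
  have hcoef : ∀ i, ∃ a : ((Fin r → ℂˣ) →* ℂ) →₀ ℂ, ∀ t,
      b.coord i (ρ (φ t) v) = a.sum fun χ c => c * χ t := by
    intro i
    obtain ⟨P, hP⟩ := hρ.exists_polynomial (b.coord i) v
    simp only [hP]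
    exact exists_finsupp_of_mem_characterAlgebra (eval_mem_of_forall_mem hent P)
  choose a ha using hcoef
  -- The coefficients of the orbit map `t ↦ ρ (φ t) v`, expanded in characters of `(ℂˣ)ʳ` with
  -- values in `V`.
  let F : ((Fin r → ℂˣ) →* ℂ) →₀ V :=
    ∑ i, (a i).mapRange (fun c => c • b i) (zero_smul ℂ (b i))
  have hF : ∀ t, ρ (φ t) v = F.sum fun χ x => χ t • x := by
    intro t
    change _ = Finsupp.liftAddHom (fun χ : (Fin r → ℂˣ) →* ℂ =>
      DistribSMul.toAddMonoidHom V (χ t)) F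
    rw [map_sum]
    conv_lhs => rw [← b.sum_repr (ρ (φ t) v)]
    refine Finset.sum_congr rfl fun i _ => ?_
    rw [Finsupp.liftAddHom_apply, Finsupp.sum_mapRange_index (by simp)]
    have := ha i t
    rw [Basis.coord_apply] at this
    rw [this, Finsupp.sum, Finsupp.sum, Finset.sum_smul]
    exact Finset.sum_congr rfl fun χ _ => by simp [smul_smul, mul_comm]
  have heig : ∀ s χ, ρ (φ s) (F χ) = χ s • F χ := by
    intro s
    -- The expansion of `ρ (φ (s * t)) v` in `t` is computed in two ways; uniqueness makes each `F
    -- χ` an eigenvector.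
    have h1 : F.mapRange (ρ (φ s)) (map_zero _) =
        Finsupp.onFinset F.support (fun χ => χ s • F χ) (fun χ h => by
          rw [Finsupp.mem_support_iff]; rintro h0; exact h (by rw [h0, smul_zero])) := by
      refine finsupp_eq_of_sum_monoidHom_smul_eq fun t => ?_
      rw [Finsupp.sum_mapRange_index (by simp), Finsupp.onFinset_sum _ (by simp)]
      have h2 := hF (s * t)
      rw [map_mul, map_mul, Module.End.mul_apply, hF t, map_finsuppSum] at h2
      simp only [map_smul] at h2
      rw [h2]
      exact Finset.sum_congr rfl fun χ _ => by
        simp only [map_mul]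
        rw [mul_comm, mul_smul]
    intro χ
    simpa using DFunLike.congr_fun h1 χ
  -- Characters of `(ℂˣ)ʳ` descend to the torus by injectivity of `φ`; where `F χ = 0` the label `0`
  -- is a default.
  have hκ : ∀ χ, ∃ a : CharLattice φ.range, IsWeightVector ρ φ.range a (F χ) := by
    intro χ
    by_cases h0 : F χ = 0
    · exact ⟨0, by rw [h0]; exact IsWeightVector.zero _ _ _⟩
    have hw : ∀ t : φ.range, ρ (t : G) (F χ) =
        ((χ.toHomUnits.comp (MonoidHom.ofInjective hinj).symm.toMonoidHom t : ℂˣ) : ℂ) • F χ := by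
      rintro ⟨_, s, rfl⟩
      rw [heig]
      have : (MonoidHom.ofInjective hinj).symm ⟨φ s, s, rfl⟩ = s := by
        rw [MulEquiv.symm_apply_eq]; rfl
      simp [this]
    exact ⟨Additive.ofMul ⟨_, mem_characterGroup_of_apply_eq_smul hρ _ h0 hw⟩, hw⟩
  choose κ hκ using hκ
  refine ⟨∑ χ ∈ F.support, Finsupp.single (κ χ) (F χ), fun b => ?_, ?_⟩
  · rw [Finsupp.finsetSum_apply]
    refine Finset.sum_induction _ (IsWeightVector ρ φ.range b) (fun _ _ => IsWeightVector.add)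
      (IsWeightVector.zero _ _ _) fun χ _ => ?_
    rw [Finsupp.single_apply]
    split_ifs with h
    · exact h ▸ hκ χ
    · exact IsWeightVector.zero _ _ _
  · change Finsupp.liftAddHom (fun _ : CharLattice φ.range => AddMonoidHom.id V) _ = v
    rw [map_sum]
    have h1 := hF 1
    rw [map_one, map_one, Module.End.one_apply] at h1
    rw [h1]
    exact Finset.sum_congr rfl fun χ _ => by simp

end Weights

/-! ### The degree of a rational module -/

section Degree

open Module

variable {V : Type*} [AddCommGroup V] [Module ℂ V]

/-- The weights of the torus `T` on `ℂⁿ`. -/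
def stdWeights (T : Subgroup G) : Set (CharLattice T) := weightSupport (leftRegular G) T 1

/-- Applying `t` to a weight decomposition of the identity matrix expresses `t` itself as a
combination of fixed matrices with weights as coefficients. -/
theorem entries_mem_span_stdWeights {T : Subgroup G} (hT : IsTorus T) (ij : Fin n × Fin n) :
    (fun t : T => entries (toMat (t : G)) ij) ∈
      Submodule.span ℂ ((fun a : CharLattice T => (charEval a : T → ℂ)) '' stdWeights T) := by
  obtain ⟨f, hf, hsum⟩ := exists_weight_decomposition isRational_leftRegular hT
    (1 : Matrix (Fin n) (Fin n) ℂ)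
  have h1 : (fun t : T => entries (toMat (t : G)) ij) =
      ∑ b ∈ f.support, (f b ij.1 ij.2) • (charEval b : T → ℂ) := by
    ext t
    have h2 : toMat (t : G) = ∑ b ∈ f.support, charEval b t • f b := by
      rw [← leftRegular_apply_one, ← hsum, Finsupp.sum, map_sum]
      exact Finset.sum_congr rfl fun b _ => hf b t
    rw [entries, h2, Matrix.sum_apply, Finset.sum_apply]
    exact Finset.sum_congr rfl fun b _ => mul_comm _ _
  rw [h1]
  refine Submodule.sum_mem _ fun b hb => Submodule.smul_mem _ _ (Submodule.subset_span ⟨b, ?_, rfl⟩)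
  exact ⟨f, hf, hsum, Finsupp.mem_support_iff.mp hb⟩

/-- A character of a torus which is a polynomial in the matrix entries is a sum of weights of the
standard representation, the number of summands being a degree occurring in the polynomial. -/
theorem exists_sum_stdWeights_of_eval {T : Subgroup G} (hT : IsTorus T) {a : CharLattice T}
    {P : MvPolynomial (Fin n × Fin n) ℂ}
    (hP : ∀ t : T, charEval a t = MvPolynomial.eval (entries (toMat (t : G))) P) :
    ∃ m ∈ P.support, ∃ f : Fin m.degree → CharLattice T, (∀ i, f i ∈ stdWeights T) ∧
      ∑ i, f i = a := by
  set N := Submodule.span ℂ ((fun a : CharLattice T => (charEval a : T → ℂ)) '' stdWeights T)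
    with hN
  set U : Set (CharLattice T) := {a | ∃ m ∈ P.support, ∃ f : Fin m.degree → CharLattice T,
    (∀ i, f i ∈ stdWeights T) ∧ ∑ i, f i = a} with hU
  -- By independence, a character in the span of a set of characters belongs to that set. A monomial
  -- of degree `d` lies in `N ^ d`, which is spanned by products of `d` standard weights.
  suffices h : (charEval a : T → ℂ) ∈
      Submodule.span ℂ ((fun a : CharLattice T => (charEval a : T → ℂ)) '' U) by
    by_contra hcon
    exact (linearIndependent_charEval T).notMem_span_image (s := U) hcon h
  have hprod : ∀ m : (Fin n × Fin n) →₀ ℕ,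
      (∏ ij ∈ m.support, (fun t : T => entries (toMat (t : G)) ij) ^ m ij) ∈ N ^ m.degree := by
    intro m
    rw [Finsupp.degree]
    change _ ∈ N ^ (∑ i ∈ m.support, m i)
    induction m.support using Finset.induction_on with
    | empty => simp
    | insert i s hi ih =>
      rw [Finset.prod_insert hi, Finset.sum_insert hi, pow_add]
      exact Submodule.mul_mem_mul
        (Submodule.pow_mem_pow _ (entries_mem_span_stdWeights hT i) _) ih
  have heval : (charEval a : T → ℂ) = ∑ m ∈ P.support, P.coeff m •
      ∏ ij ∈ m.support, (fun t : T => entries (toMat (t : G)) ij) ^ m ij := by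
    ext t
    rw [hP, MvPolynomial.eval_eq, Finset.sum_apply]
    refine Finset.sum_congr rfl fun m _ => ?_
    simp [Finset.prod_apply]
  rw [heval]
  refine Submodule.sum_mem _ fun m hm => Submodule.smul_mem _ _ ?_
  have hm' := hprod m
  rw [hN, Submodule.span_pow] at hm'
  refine Submodule.span_mono ?_ hm'
  intro y hy
  obtain ⟨f, hf⟩ := Set.mem_pow.mp hy
  choose g hg hgf using fun i => (f i).2
  refine ⟨∑ i, g i, ⟨m, hm, g, hg, rfl⟩, ?_⟩
  rw [← hf, List.prod_ofFn]
  ext t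
  simp only [charEval_sum, Finset.prod_apply, ← hgf]

/-- All matrix coefficients are combinations of the finitely many attached to a basis. The uniform
`D` yields one dilation factor for all vectors and all tori. -/
theorem exists_degree_bound [FiniteDimensional ℂ V] {ρ : Representation ℂ G V}
    (hρ : IsRational ρ) : ∃ D : ℕ, ∀ (l : Module.Dual ℂ V) (x : V),
      ∃ P : MvPolynomial (Fin n × Fin n) ℂ, P.totalDegree ≤ D ∧ ∀ g : G,
        l (ρ g x) = MvPolynomial.eval (entries (toMat g)) P := by
  let b := finBasis ℂ V
  choose P hP using fun i j => hρ.exists_polynomial (b.coord i) (b j)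
  refine ⟨Finset.univ.sup fun i => Finset.univ.sup fun j => (P i j).totalDegree, fun l x =>
    ⟨∑ j, ∑ i, MvPolynomial.C (b.repr x j * l (b i)) * P i j, ?_, fun g => ?_⟩⟩
  · refine MvPolynomial.totalDegree_finsetSum_le fun j _ =>
      MvPolynomial.totalDegree_finsetSum_le fun i _ => ?_
    refine (MvPolynomial.totalDegree_mul _ _).trans ?_
    rw [MvPolynomial.totalDegree_C, zero_add]
    exact (Finset.le_sup (f := fun j => (P i j).totalDegree) (Finset.mem_univ j)).trans
      (Finset.le_sup (f := fun i => Finset.univ.sup fun j => (P i j).totalDegree)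
        (Finset.mem_univ i))
  · conv_lhs => rw [← b.sum_repr x, map_sum, map_sum]
    rw [map_sum]
    refine Finset.sum_congr rfl fun j _ => ?_
    rw [map_smul, map_smul, ← b.sum_repr (ρ g (b j)), map_sum, map_sum, Finset.smul_sum]
    refine Finset.sum_congr rfl fun i _ => ?_
    simp only [map_smul, smul_eq_mul, map_mul, MvPolynomial.eval_C, ← hP, Basis.coord_apply]
    ring

theorem exists_eval_of_mem_weightSupport {ρ : Representation ℂ G V} {T : Subgroup G} {v : V}
    {a : CharLattice T} (ha : a ∈ weightSupport ρ T v) : ∃ (l : Module.Dual ℂ V) (x : V),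
      ∀ t : T, charEval a t = l (ρ (t : G) x) := by
  obtain ⟨f, hf, -, ha⟩ := ha
  obtain ⟨l, hl⟩ : ∃ l : Module.Dual ℂ V, l (f a) ≠ 0 := by
    by_contra! hcon
    exact ha ((Module.forall_dual_apply_eq_zero_iff ℂ _).mp hcon)
  refine ⟨(l (f a))⁻¹ • l, f a, fun t => ?_⟩
  rw [hf a t]
  simp [hl]

/-- The weight polytope of the identity matrix. -/
abbrev stdPolytope (T : Subgroup G) : Set (CharSpace T) :=
  weightPolytope (leftRegular G) T (1 : Matrix (Fin n) (Fin n) ℂ)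

theorem sum_tmul_mem_smul_stdPolytope {T : Subgroup G} {k : ℕ} (hk : 0 < k)
    {f : Fin k → CharLattice T} (hf : ∀ i, f i ∈ stdWeights T) :
    (1 : ℝ) ⊗ₜ[ℤ] (∑ i, f i) ∈ (k : ℝ) • stdPolytope T := by
  have hk' : (k : ℝ) ≠ 0 := by positivity
  rw [Set.mem_smul_set_iff_inv_smul_mem₀ hk', TensorProduct.tmul_sum, Finset.smul_sum]
  refine (convex_convexHull ℝ _).sum_mem (fun _ _ => by positivity) (by simp [hk'])
    fun i _ => subset_convexHull ℝ _ ⟨f i, hf i, rfl⟩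

/-- The trivial character is the determinant on `T`, a homogeneous polynomial of degree `n` in the
entries. Hence `0` is a sum of `n` standard weights, and dividing by `n` makes it their barycentre.
-/
theorem zero_mem_stdPolytope (hn : 0 < n) {T : Subgroup G} (hT : IsTorus T) :
    (0 : CharSpace T) ∈ stdPolytope T := by
  obtain ⟨m, hm, f, hf, hsum⟩ := exists_sum_stdWeights_of_eval hT (a := 0)
    (P := (Matrix.mvPolynomialX (Fin n) (Fin n) ℂ).det) fun t => by
      rw [charEval_zero, ← det_toMat (t : G), RingHom.map_det]
      congr 1
      ext i j
      simp [Matrix.mvPolynomialX, entries]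
  have hdeg : m.degree = n := by
    have hhom : (Matrix.mvPolynomialX (Fin n) (Fin n) ℂ).det.IsHomogeneous n := by
      rw [Matrix.det_apply]
      refine MvPolynomial.IsHomogeneous.sum _ _ _ fun s _ => ?_
      rw [Units.smul_def, zsmul_eq_mul, ← map_intCast (MvPolynomial.C : ℂ →+* _)]
      have h1 := MvPolynomial.IsHomogeneous.prod Finset.univ
        (fun i => Matrix.mvPolynomialX (Fin n) (Fin n) ℂ (s i) i) (fun _ => 1)
        fun i _ => MvPolynomial.isHomogeneous_X ℂ _
      have h2 := (MvPolynomial.isHomogeneous_C (Fin n × Fin n)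
        (((Equiv.Perm.sign s : ℤˣ) : ℤ) : ℂ)).mul h1
      simpa using h2
    have := hhom (MvPolynomial.mem_support_iff.mp hm)
    refine Eq.trans ?_ this
    rw [Finsupp.weight_apply]
    simp [Finsupp.degree_apply, Finsupp.sum]
  have h1 := sum_tmul_mem_smul_stdPolytope (hn.trans_eq hdeg.symm) hf
  have hne : ((m.degree : ℕ) : ℝ) ≠ 0 := by rw [hdeg]; positivity
  rwa [hsum, TensorProduct.tmul_zero, Set.mem_smul_set_iff_inv_smul_mem₀ hne, smul_zero] at h1

/-- Some `k` is admissible, so the degree is an actual minimum and not the default value `0` of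
`sInf`. -/
theorem degree_spec (hn : 0 < n) [FiniteDimensional ℂ V] {ρ : Representation ℂ G V}
    (hρ : IsRational ρ) : 0 < degree ρ ∧ ∀ T : Subgroup G, IsMaximalTorus T → ∀ v : V, v ≠ 0 →
      weightPolytope ρ T v ⊆ (degree ρ : ℝ) • stdPolytope T := by
  refine Nat.sInf_mem (s := {k : ℕ | 0 < k ∧ ∀ T : Subgroup G, IsMaximalTorus T → ∀ v : V, v ≠ 0 →
      weightPolytope ρ T v ⊆ (k : ℝ) • stdPolytope T}) ?_
  obtain ⟨D, hD⟩ := exists_degree_bound hρ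
  -- `D` itself may be `0`, while the factor must be positive.
  refine ⟨D + 1, Nat.succ_pos D, fun T hT v _ => ?_⟩
  have hconv : Convex ℝ (stdPolytope T) := convex_convexHull ℝ _
  have h0 := zero_mem_stdPolytope hn hT.prop
  refine convexHull_min ?_ (hconv.smul _)
  rintro _ ⟨a, ha, rfl⟩
  obtain ⟨l, x, hlx⟩ := exists_eval_of_mem_weightSupport ha
  obtain ⟨P, hPD, hP⟩ := hD l x
  obtain ⟨m, hm, f, hf, rfl⟩ := exists_sum_stdWeights_of_eval hT.prop (a := a) (P := P) fun t => by
    rw [hlx, hP]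
  have hmD : m.degree ≤ D := (MvPolynomial.le_totalDegree hm).trans hPD
  have hD1 : ((D + 1 : ℕ) : ℝ) ≠ 0 := by positivity
  rw [Set.mem_smul_set_iff_inv_smul_mem₀ hD1]
  rcases Nat.eq_zero_or_pos m.degree with h | h
  · have : (1 : ℝ) ⊗ₜ[ℤ] (∑ i, f i) = 0 := by
      have : IsEmpty (Fin m.degree) := by rw [h]; infer_instance
      simp
    simp only [this, smul_zero]
    exact h0
  · obtain ⟨y, hy, hyeq⟩ := sum_tmul_mem_smul_stdPolytope h hf
    simp only at hyeq ⊢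
    rw [← hyeq, smul_smul]
    -- A sum of fewer than `D + 1` standard weights also lies in the `D + 1` dilate, because the
    -- polytope is convex and contains `0`.
    refine hconv.smul_mem_of_zero_mem h0 hy ⟨by positivity, ?_⟩
    rw [inv_mul_le_iff₀ (by positivity), mul_one]
    exact_mod_cast hmD.trans (Nat.le_succ D)

end Degree

/-! ### Maximal tori -/

section MaximalTori

theorem toMat_injective : Function.Injective (toMat : G → Matrix (Fin n) (Fin n) ℂ) :=
  Subtype.val_injective.comp Subtype.val_injective

theorem toMat_mul (g h : G) : toMat (g * h) = toMat g * toMat h := by simp [toMat]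

theorem toMat_one : toMat (1 : G) = 1 := by simp [toMat]

/-- `u` is a one-parameter subgroup with velocity `X`. -/
def HasVelocity (u : Multiplicative ℂ →* G) (X : Matrix (Fin n) (Fin n) ℂ) : Prop :=
  ∀ i j, HasDerivAt (fun z : ℂ => toMat (u (Multiplicative.ofAdd z)) i j) (X i j) 0

theorem HasVelocity.hasDerivAt {u : Multiplicative ℂ →* G} {X : Matrix (Fin n) (Fin n) ℂ}
    (h : HasVelocity u X) (z : ℂ) (i j : Fin n) :
    HasDerivAt (fun z : ℂ => toMat (u (Multiplicative.ofAdd z)) i j)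
      ((toMat (u (Multiplicative.ofAdd z)) * X) i j) z ∧
    HasDerivAt (fun z : ℂ => toMat (u (Multiplicative.ofAdd z)) i j)
      ((X * toMat (u (Multiplicative.ofAdd z))) i j) z := by
  have h0 : ∀ k l, HasDerivAt (fun w : ℂ => toMat (u (Multiplicative.ofAdd (w - z))) k l)
      (X k l) z := fun k l => by
    have h1 : HasDerivAt (fun z : ℂ => toMat (u (Multiplicative.ofAdd z)) k l) (X k l) (z - z) := by
      rw [sub_self]; exact h k l
    exact h1.comp_sub_const z z
  constructor
  · have h1 : (fun w : ℂ => toMat (u (Multiplicative.ofAdd w)) i j) = fun w =>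
        ∑ k, toMat (u (Multiplicative.ofAdd z)) i k * toMat (u (Multiplicative.ofAdd (w - z))) k j := by
      ext w
      rw [← Matrix.mul_apply, ← toMat_mul, ← map_mul, ← ofAdd_add, add_sub_cancel]
    rw [h1, Matrix.mul_apply]
    exact HasDerivAt.fun_sum fun k _ => (h0 k j).const_mul _
  · have h1 : (fun w : ℂ => toMat (u (Multiplicative.ofAdd w)) i j) = fun w =>
        ∑ k, toMat (u (Multiplicative.ofAdd (w - z))) i k * toMat (u (Multiplicative.ofAdd z)) k j := by
      ext w
      rw [← Matrix.mul_apply, ← toMat_mul, ← map_mul, ← ofAdd_add, sub_add_cancel]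
    rw [h1, Matrix.mul_apply]
    exact HasDerivAt.fun_sum fun k _ => (h0 i k).mul_const _

/-- The product `u(-z) v(z)` has derivative `-u(-z) X v(z) + u(-z) X v(z) = 0`, so it is constantly
the identity. -/
theorem HasVelocity.eq {u v : Multiplicative ℂ →* G} {X : Matrix (Fin n) (Fin n) ℂ}
    (hu : HasVelocity u X) (hv : HasVelocity v X) : u = v := by
  have hderiv : ∀ i j (z : ℂ), HasDerivAt (fun z : ℂ =>
      (toMat (u (Multiplicative.ofAdd (-z))) * toMat (v (Multiplicative.ofAdd z))) i j) 0 z := by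
    intro i j z
    simp only [Matrix.mul_apply]
    have h1 : ∀ k, HasDerivAt (fun z : ℂ => toMat (u (Multiplicative.ofAdd (-z))) i k)
        (-(toMat (u (Multiplicative.ofAdd (-z))) * X) i k) z := fun k => by
      have h3 := (hu.hasDerivAt (-z) i k).1
      rw [← zero_sub z] at h3
      simpa only [zero_sub] using h3.comp_const_sub 0 z
    have h2 := HasDerivAt.fun_sum (u := Finset.univ) fun k _ =>
      (h1 k).fun_mul (hv.hasDerivAt z k j).2
    refine h2.congr_deriv ?_
    rw [Finset.sum_add_distrib]
    simp only [neg_mul, Finset.sum_neg_distrib]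
    rw [← Matrix.mul_apply, ← Matrix.mul_apply, Matrix.mul_assoc, neg_add_cancel]
  refine MonoidHom.ext fun z => ?_
  have hone : toMat (u (Multiplicative.ofAdd (-z.toAdd))) * toMat (v z) = 1 := by
    ext i j
    have := is_const_of_deriv_eq_zero (fun z => (hderiv i j z).differentiableAt)
      (fun z => (hderiv i j z).deriv) z.toAdd 0
    simpa [toMat_one] using this
  rw [← toMat_mul, ← toMat_one, ofAdd_neg, ofAdd_toAdd, map_inv] at hone
  have := toMat_injective hone
  exact inv_mul_eq_one.mp this

theorem IsTorus.mul_comm {T : Subgroup G} (hT : IsTorus T) {s t : G} (hs : s ∈ T) (ht : t ∈ T) :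
    s * t = t * s := by
  obtain ⟨r, φ, -, rfl, -⟩ := hT
  obtain ⟨a, rfl⟩ := hs
  obtain ⟨b, rfl⟩ := ht
  rw [← map_mul, ← map_mul, _root_.mul_comm]

/-- The Lie algebra of a torus. -/
def lieAlgebra (T : Subgroup G) (hT : IsTorus T) : Submodule ℂ (Matrix (Fin n) (Fin n) ℂ) where
  carrier := {X | ∃ u : Multiplicative ℂ →* G, (∀ z, u z ∈ T) ∧ HasVelocity u X}
  zero_mem' := ⟨1, fun _ => T.one_mem, fun i j => by simpa using hasDerivAt_const (0 : ℂ) _⟩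
  add_mem' := by
    rintro X Y ⟨u, hu, huX⟩ ⟨v, hv, hvY⟩
    refine ⟨{ toFun := fun z => u z * v z
              map_one' := by simp
              map_mul' := fun z w => by
                rw [map_mul, map_mul, mul_assoc, ← mul_assoc (u w), hT.mul_comm (hu w) (hv z)]
                simp only [mul_assoc] }, fun z => T.mul_mem (hu z) (hv z), fun i j => ?_⟩
    simp only [MonoidHom.coe_mk, OneHom.coe_mk, toMat_mul, Matrix.mul_apply]
    have h2 := HasDerivAt.fun_sum (u := Finset.univ) fun k _ => (huX i k).fun_mul (hvY k j)
    refine h2.congr_deriv ?_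
    simp only [ofAdd_zero, map_one, toMat_one, Finset.sum_add_distrib, ← Matrix.mul_apply, mul_one,
      one_mul, Matrix.add_apply]
  smul_mem' := by
    rintro c X ⟨u, hu, huX⟩
    refine ⟨u.comp (AddMonoidHom.toMultiplicative (AddMonoidHom.mulLeft c)), fun z => hu _,
      fun i j => ?_⟩
    have h1 : HasDerivAt (fun z : ℂ => c * z) c 0 := by
      simpa using (hasDerivAt_id (0 : ℂ)).const_mul c
    have h2 : HasDerivAt (fun z : ℂ => toMat (u (Multiplicative.ofAdd z)) i j) (X i j) (c * 0) := by
      rw [mul_zero]; exact huX i j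
    have h3 := h2.comp (0 : ℂ) h1
    rw [mul_comm] at h3
    exact h3

theorem differentiable_eval {ι : Type*} {x : ℂ → ι → ℂ}
    (hx : ∀ i, Differentiable ℂ fun z => x z i) (P : MvPolynomial ι ℂ) :
    Differentiable ℂ fun z => MvPolynomial.eval (x z) P := by
  induction P using MvPolynomial.induction_on with
  | C c => simp
  | add P Q hP hQ => simpa using hP.fun_add hQ
  | mul_X P i hP => simpa using hP.fun_mul (hx i)

/-- Logarithms of the coordinates of `t` in `(ℂˣ)ʳ` give a holomorphic one-parameter subgroup of `T`
through `t`. -/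
theorem IsTorus.exists_hasVelocity {T : Subgroup G} (hT : IsTorus T) {t : G} (ht : t ∈ T) :
    ∃ (u : Multiplicative ℂ →* G) (X : Matrix (Fin n) (Fin n) ℂ), (∀ z, u z ∈ T) ∧
      u (Multiplicative.ofAdd 1) = t ∧ HasVelocity u X := by
  obtain ⟨r, φ, -, rfl, hφ⟩ := hT
  obtain ⟨s, rfl⟩ := ht
  have hexp : ∀ j, ∃ τ : ℂ, Complex.exp τ = s j := fun j =>
    ⟨Complex.log (s j), Complex.exp_log (s j).ne_zero⟩
  choose τ hτ using hexp
  let e : Multiplicative ℂ →* (Fin r → ℂˣ) :=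
    { toFun := fun z j => Units.mk0 (Complex.exp (z.toAdd * τ j)) (Complex.exp_ne_zero _)
      map_one' := by ext j; simp
      map_mul' := fun z w => by ext j; simp [add_mul, Complex.exp_add] }
  have hdiff : ∀ i j, Differentiable ℂ fun z : ℂ => toMat (φ (e (Multiplicative.ofAdd z))) i j := by
    intro i j
    obtain ⟨P, hP⟩ := hφ i j
    simp only [hP]
    refine differentiable_eval (fun k => ?_) P
    rcases k with k | k
    · simp only [Sum.elim_inl, e, MonoidHom.coe_mk, OneHom.coe_mk, Units.val_mk0, toAdd_ofAdd]
      fun_prop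
    · simp only [Sum.elim_inr, e, MonoidHom.coe_mk, OneHom.coe_mk, Units.val_mk0, toAdd_ofAdd,
        ← Complex.exp_neg]
      fun_prop
  refine ⟨φ.comp e, fun i j => deriv (fun z : ℂ => toMat (φ (e (Multiplicative.ofAdd z))) i j) 0,
    fun z => ⟨e z, rfl⟩, ?_, fun i j => (hdiff i j 0).hasDerivAt⟩
  have : e (Multiplicative.ofAdd 1) = s := by
    ext j; simp [e, hτ]
  simp [this]

theorem lieAlgebra_mono {S T : Subgroup G} (hS : IsTorus S) (hT : IsTorus T) (h : S ≤ T) :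
    lieAlgebra S hS ≤ lieAlgebra T hT := fun _ ⟨u, hu, huX⟩ => ⟨u, fun z => h (hu z), huX⟩

/-- Each element of `S` is the time-one value of a one-parameter subgroup, which is determined by
its velocity and therefore is one of `T`. -/
theorem le_of_lieAlgebra_le {S T : Subgroup G} (hS : IsTorus S) (hT : IsTorus T)
    (h : lieAlgebra S hS ≤ lieAlgebra T hT) : S ≤ T := by
  intro s hs
  obtain ⟨u, X, hu, rfl, huX⟩ := hS.exists_hasVelocity hs
  obtain ⟨v, hv, hvX⟩ := h (show X ∈ lieAlgebra S hS from ⟨u, hu, huX⟩)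
  rw [huX.eq hvX]
  exact hv _

/-- Every torus is contained in a maximal torus. -/
theorem IsTorus.exists_le_isMaximalTorus {S : Subgroup G} (hS : IsTorus S) :
    ∃ T, S ≤ T ∧ IsMaximalTorus T := by
  -- Finite dimension of the matrix space gives a torus containing `S` whose Lie algebra is maximal;
  -- such a torus is maximal.
  obtain ⟨L, ⟨T, hT, hST, rfl⟩, hmax⟩ := WellFounded.has_min
    (wellFounded_gt (α := Submodule ℂ (Matrix (Fin n) (Fin n) ℂ)))
    {L | ∃ (T : Subgroup G) (hT : IsTorus T), S ≤ T ∧ lieAlgebra T hT = L} ⟨_, S, hS, le_rfl, rfl⟩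
  refine ⟨T, hST, hT, fun T' hT' hle => le_of_lieAlgebra_le hT' hT ?_⟩
  have h1 := hmax _ ⟨T', hT', hST.trans hle, rfl⟩
  by_contra hcon
  exact h1 (lt_of_le_not_ge (lieAlgebra_mono hT hT' hle) hcon)

end MaximalTori

/-! ### Tori containing the powers of a positive definite matrix -/

section PositiveTorus

open Matrix

/-- The matrix with eigenvalues `x` and eigenvectors the columns of the unitary matrix `U`. -/
def conjDiag (U : Matrix (Fin n) (Fin n) ℂ) (x : Fin n → ℂ) : Matrix (Fin n) (Fin n) ℂ :=
  U * diagonal x * Uᴴ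

theorem conjDiag_apply (U : Matrix (Fin n) (Fin n) ℂ) (x : Fin n → ℂ) (i j : Fin n) :
    conjDiag U x i j = ∑ k, U i k * x k * star (U j k) := by
  rw [conjDiag, mul_apply]
  simp [mul_diagonal]

theorem conjDiag_mul {U : Matrix (Fin n) (Fin n) ℂ} (hU : Uᴴ * U = 1) (x y : Fin n → ℂ) :
    conjDiag U x * conjDiag U y = conjDiag U (x * y) := by
  calc conjDiag U x * conjDiag U y = U * diagonal x * (Uᴴ * U) * diagonal y * Uᴴ := by
        simp only [conjDiag, Matrix.mul_assoc]
    _ = conjDiag U (x * y) := by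
        rw [hU, Matrix.mul_one, Matrix.mul_assoc U, diagonal_mul_diagonal]; rfl

theorem conjDiag_one {U : Matrix (Fin n) (Fin n) ℂ} (hU : Uᴴ * U = 1) : conjDiag U 1 = 1 := by
  have : diagonal (1 : Fin n → ℂ) = 1 := diagonal_one
  rw [conjDiag, this, Matrix.mul_one, mul_eq_one_comm.mp hU]

theorem conjDiag_pow {U : Matrix (Fin n) (Fin n) ℂ} (hU : Uᴴ * U = 1) (x : Fin n → ℂ) (k : ℕ) :
    conjDiag U x ^ k = conjDiag U (x ^ k) := by
  induction k with
  | zero => rw [pow_zero, pow_zero, conjDiag_one hU]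
  | succ k ih => rw [pow_succ, pow_succ, ih, conjDiag_mul hU]

theorem conjDiag_injective {U : Matrix (Fin n) (Fin n) ℂ} (hU : Uᴴ * U = 1) :
    Function.Injective (conjDiag U) := by
  intro x y h
  have h1 : ∀ z, Uᴴ * conjDiag U z * U = diagonal z := fun z => by
    calc Uᴴ * conjDiag U z * U = (Uᴴ * U) * diagonal z * (Uᴴ * U) := by
          simp only [conjDiag, Matrix.mul_assoc]
      _ = diagonal z := by rw [hU, Matrix.one_mul, Matrix.mul_one]
  exact diagonal_injective (by rw [← h1, ← h1, h])

/-- An equation of `G`, evaluated at the universal matrix over the group algebra of `Λ`, becomes a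
finite sum with coefficients `c_κ`. By `H`, `∑ c_κ e^{k κ} = 0` for all `k`, and the sequences `k ↦
e^{k κ}` are independent for distinct `κ`. Hence all `c_κ` vanish and the equation holds for every
`χ`. -/
theorem exists_toMat_eq_conjDiag (hG : IsAlgebraicGroup G) {U : Matrix (Fin n) (Fin n) ℂ}
    {Λ : Submodule ℤ ℝ} (l : Fin n → Λ)
    (H : ∀ k : ℕ, ∃ g : G, toMat g = conjDiag U fun i => (Real.exp (l i) : ℂ) ^ k)
    (χ : Multiplicative Λ →* ℂ) :
    ∃ g : G, toMat g = conjDiag U fun i => χ (Multiplicative.ofAdd (l i)) := by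
  obtain ⟨E, hE⟩ := hG
  rw [hE]
  intro P hP
  let y : Fin n × Fin n → AddMonoidAlgebra ℂ Λ := fun ij =>
    ∑ k, (U ij.1 k * star (U ij.2 k)) • AddMonoidAlgebra.single (l k) (1 : ℂ)
  have hlift : ∀ ψ : Multiplicative Λ →* ℂ,
      AddMonoidAlgebra.lift ℂ ℂ Λ ψ (MvPolynomial.aeval y P) =
      MvPolynomial.eval (entries (conjDiag U fun i => ψ (Multiplicative.ofAdd (l i)))) P := by
    intro ψ
    have h1 : (AddMonoidAlgebra.lift ℂ ℂ Λ ψ).comp (MvPolynomial.aeval y) =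
        MvPolynomial.aeval (entries (conjDiag U fun i => ψ (Multiplicative.ofAdd (l i)))) := by
      ext ij
      simp [y, entries, conjDiag_apply, AddMonoidAlgebra.lift_single, mul_right_comm]
    have := DFunLike.congr_fun h1 P
    rwa [MvPolynomial.aeval_eq_eval] at this
  suffices h0 : MvPolynomial.aeval y P = 0 by
    rw [← hlift, h0, map_zero]
  have hli : LinearIndependent ℂ fun κ : Λ =>
      (powersHom ℂ (Real.exp κ : ℂ) : Multiplicative ℕ → ℂ) :=
    (linearIndependent_monoidHom (Multiplicative ℕ) ℂ).comp
      (fun κ : Λ => powersHom ℂ (Real.exp κ : ℂ)) fun κ κ' h => by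
        have := (powersHom ℂ).injective h
        exact Subtype.ext (Real.exp_injective (by exact_mod_cast this))
  have hcoeff : (MvPolynomial.aeval y P : AddMonoidAlgebra ℂ Λ).coeff = 0 := by
    refine hli ?_
    rw [map_zero]
    ext k
    obtain ⟨g, hg⟩ := H k.toAdd
    let ψ : Multiplicative Λ →* ℂ :=
      { toFun := fun κ => (Real.exp κ.toAdd : ℂ) ^ k.toAdd
        map_one' := by simp
        map_mul' := fun κ κ' => by simp [Complex.exp_add, mul_pow] }
    have h1 := hlift ψ
    have h2 : (conjDiag U fun i => ψ (Multiplicative.ofAdd (l i))) = toMat g := hg.symm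
    rw [h2, (hE _).mp ⟨g, rfl⟩ P hP, AddMonoidAlgebra.lift_apply] at h1
    rw [Finsupp.linearCombination_apply, Finsupp.sum, Finset.sum_apply]
    exact h1
  exact AddMonoidAlgebra.coeff_injective hcoeff

/-- The Laurent monomial `t ^ z` in the variables `t` and `t⁻¹`. -/
theorem exists_eval_eq_prod_zpow {r : ℕ} (c : Fin r → ℤ) :
    ∃ P : MvPolynomial (Fin r ⊕ Fin r) ℂ, ∀ t : Fin r → ℂˣ,
      MvPolynomial.eval (Sum.elim (fun k => (t k : ℂ)) (fun k => ((t k)⁻¹ : ℂ))) P =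
        ∏ j, (t j : ℂ) ^ c j := by
  have h1 : ∀ (j : Fin r) (z : ℤ), ∃ P : MvPolynomial (Fin r ⊕ Fin r) ℂ, ∀ t : Fin r → ℂˣ,
      MvPolynomial.eval (Sum.elim (fun k => (t k : ℂ)) (fun k => ((t k)⁻¹ : ℂ))) P =
        (t j : ℂ) ^ z := by
    intro j z
    obtain ⟨m, rfl | rfl⟩ := z.eq_nat_or_neg
    · exact ⟨MvPolynomial.X (Sum.inl j) ^ m, fun t => by simp⟩
    · exact ⟨MvPolynomial.X (Sum.inr j) ^ m, fun t => by simp⟩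
  choose P hP using h1
  exact ⟨∏ j, P j (c j), fun t => by rw [map_prod]; exact Finset.prod_congr rfl fun j _ => hP _ _ _⟩

/-- If all powers of a positive definite matrix lie in an algebraic group, then its complex powers
lie in a torus of the group. -/
theorem exists_isTorus_of_pow_mem (hG : IsAlgebraicGroup G) {U : Matrix (Fin n) (Fin n) ℂ}
    (hU : Uᴴ * U = 1) (l : Fin n → ℝ)
    (H : ∀ k : ℕ, ∃ g : G, toMat g = conjDiag U fun i => (Real.exp (l i) : ℂ) ^ k) :
    ∃ T : Subgroup G, IsTorus T ∧ ∃ γ : ℂ → G, (∀ z, γ z ∈ T) ∧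
      ∀ z, toMat (γ z) = conjDiag U fun i => Complex.exp (z * l i) := by
  -- The exponents may satisfy integral relations. Their span is finitely generated and
  -- torsion-free, and a `ℤ`-basis of it gives independent coordinates on the torus.
  let Λ : Submodule ℤ ℝ := Submodule.span ℤ (Set.range l)
  have hfin : Module.Finite ℤ Λ := Module.Finite.span_of_finite ℤ (Set.finite_range l)
  let b := Module.finBasis ℤ Λ
  let L : Fin n → Λ := fun i => ⟨l i, Submodule.subset_span ⟨i, rfl⟩⟩
  let χ : (Fin (Module.finrank ℤ Λ) → ℂˣ) → Multiplicative Λ →* ℂˣ := fun t =>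
    { toFun := fun κ => ∏ j, t j ^ b.repr κ.toAdd j
      map_one' := by simp
      map_mul' := fun κ κ' => by simp [_root_.zpow_add, Finset.prod_mul_distrib] }
  have hχmul : ∀ s t κ, χ (s * t) κ = χ s κ * χ t κ := fun s t κ => by
    simp [χ, mul_zpow, Finset.prod_mul_distrib]
  choose φ hφ using fun t => exists_toMat_eq_conjDiag hG L H ((Units.coeHom ℂ).comp (χ t))
  replace hφ : ∀ t, toMat (φ t) = conjDiag U fun i => (χ t (Multiplicative.ofAdd (L i)) : ℂ) := hφ
  have hφmul : ∀ s t, φ (s * t) = φ s * φ t := fun s t => toMat_injective (by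
    rw [toMat_mul, hφ, hφ, hφ, conjDiag_mul hU]
    congr 1
    ext i
    simp [hχmul])
  let Φ : (Fin (Module.finrank ℤ Λ) → ℂˣ) →* G := MonoidHom.mk' φ hφmul
  refine ⟨Φ.range, ⟨_, Φ, ?_, rfl, fun i j => ?_⟩, fun z => φ fun j =>
    Units.mk0 (Complex.exp (z * b j)) (Complex.exp_ne_zero _), fun z => ⟨_, rfl⟩, fun z => ?_⟩
  -- The `l i` generate `Λ`, so a character trivial on them is trivial on the basis, where its
  -- values are the coordinates `t j`.
  · rw [injective_iff_map_eq_one]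
    intro t ht
    have h1 : toMat (φ t) = 1 := by rw [← toMat_one]; exact congrArg toMat ht
    rw [hφ, ← conjDiag_one hU] at h1
    have h2 : ∀ i, χ t (Multiplicative.ofAdd (L i)) = 1 := fun i =>
      Units.ext (congrFun (conjDiag_injective hU h1) i)
    have h3 : ∀ κ (hκ : κ ∈ Λ), χ t (Multiplicative.ofAdd ⟨κ, hκ⟩) = 1 := by
      intro κ hκ
      induction hκ using Submodule.span_induction with
      | mem x hx => obtain ⟨i, rfl⟩ := hx; exact h2 i
      | zero => exact map_one (χ t)
      | add x y hx hy h h' =>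
        have := map_mul (χ t) (Multiplicative.ofAdd ⟨x, hx⟩) (Multiplicative.ofAdd ⟨y, hy⟩)
        rw [h, h', one_mul] at this
        exact this
      | smul a x hx h =>
        have := map_zpow (χ t) (Multiplicative.ofAdd ⟨x, hx⟩) a
        rw [h, _root_.one_zpow] at this
        exact this
    ext j
    have h4 := h3 (b j) (b j).2
    simp only [χ, MonoidHom.coe_mk, OneHom.coe_mk, toAdd_ofAdd, Subtype.coe_eta,
      Module.Basis.repr_self] at h4
    rw [Finset.prod_eq_single j (fun k _ hk => by rw [Finsupp.single_eq_of_ne hk, zpow_zero])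
      (by simp), Finsupp.single_eq_same, zpow_one] at h4
    rw [h4]; rfl
  · choose P hP using fun k => exists_eval_eq_prod_zpow fun m => b.repr (L k) m
    refine ⟨∑ k, MvPolynomial.C (U i k * star (U j k)) * P k, fun t => ?_⟩
    change toMat (φ t) i j = _
    rw [hφ, conjDiag_apply, map_sum]
    refine Finset.sum_congr rfl fun k _ => ?_
    rw [map_mul, MvPolynomial.eval_C, hP]
    simp only [χ, MonoidHom.coe_mk, OneHom.coe_mk, toAdd_ofAdd, Units.coe_prod, Units.val_zpow_eq_zpow_val]
    ring
  · rw [hφ]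
    congr 1
    ext i
    simp only [χ, MonoidHom.coe_mk, OneHom.coe_mk, toAdd_ofAdd, Units.coe_prod,
      Units.val_zpow_eq_zpow_val, Units.val_mk0, ← Complex.exp_int_mul, ← Complex.exp_sum]
    congr 1
    have h1 := congrArg (Subtype.val : Λ → ℝ) (b.sum_repr (L i))
    have h2 : l i = ∑ j, (b.repr (L i) j : ℝ) * (b j : ℝ) := by
      refine h1.symm.trans ((Submodule.coe_sum _ _ _).trans (Finset.sum_congr rfl fun j _ => ?_))
      rw [Submodule.coe_smul, zsmul_eq_mul]
    rw [h2]
    push_cast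
    rw [Finset.mul_sum]
    exact Finset.sum_congr rfl fun j _ => by ring

end PositiveTorus

/-! ### The growth of a rational module along one-parameter subgroups -/

section Growth

open Matrix

theorem norm_eval_le_of_norm_le_one {ι : Type*} (P : MvPolynomial ι ℂ) {x : ι → ℂ}
    (hx : ∀ i, ‖x i‖ ≤ 1) : ‖MvPolynomial.eval x P‖ ≤ ∑ m ∈ P.support, ‖P.coeff m‖ := by
  rw [MvPolynomial.eval_eq]
  refine norm_sum_le_of_le _ fun m _ => ?_
  rw [norm_mul, norm_prod]
  refine mul_le_of_le_one_right (norm_nonneg _)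
    (Finset.prod_le_one (fun _ _ => norm_nonneg _) fun i _ => ?_)
  rw [norm_pow]
  exact pow_le_one₀ (norm_nonneg _) (hx i)

/-- The unitary elements of `G` act on a rational module by uniformly bounded operators. -/
theorem exists_norm_apply_le_of_unitary {V : Type*} [NormedAddCommGroup V] [NormedSpace ℂ V]
    [FiniteDimensional ℂ V] {ρ : Representation ℂ G V} (hρ : IsRational ρ) :
    ∃ M : ℝ, 0 < M ∧ ∀ g : G, (toMat g)ᴴ * toMat g = 1 → ∀ x, ‖ρ g x‖ ≤ M * ‖x‖ := by
  let b := Module.finBasis ℂ V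
  choose P hP using fun i j => hρ.exists_polynomial (b.coord i) (b j)
  obtain ⟨c, C, hc, hC, hb⟩ := exists_norm_equivFun_bounds b
  let K : ℝ := ∑ i, ∑ j, ∑ m ∈ (P i j).support, ‖(P i j).coeff m‖
  have hK : 0 ≤ K := by positivity
  refine ⟨(c⁻¹ * (K * C)) + 1, by positivity, fun g hg x => ?_⟩
  have hg' : toMat g ∈ Matrix.unitaryGroup (Fin n) ℂ := Matrix.mem_unitaryGroup_iff'.mpr hg
  have h1 : ‖b.equivFun (ρ g x)‖ ≤ K * ‖b.equivFun x‖ := by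
    rw [pi_norm_le_iff_of_nonneg (by positivity)]
    intro i
    have h2 : b.equivFun (ρ g x) i = ∑ j, b.equivFun x j *
        MvPolynomial.eval (entries (toMat g)) (P i j) := by
      change b.coord i (ρ g x) = _
      conv_lhs => rw [← b.sum_equivFun x]
      simp only [map_sum, map_smul, smul_eq_mul, hP]
    rw [h2]
    calc _ ≤ ∑ j, ‖b.equivFun x‖ * ∑ m ∈ (P i j).support, ‖(P i j).coeff m‖ := by
          refine norm_sum_le_of_le _ fun j _ => ?_
          rw [norm_mul]
          exact mul_le_mul (norm_le_pi_norm _ j) (norm_eval_le_of_norm_le_one _ fun ij =>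
            entry_norm_bound_of_unitary hg' ij.1 ij.2) (norm_nonneg _) (norm_nonneg _)
      _ = (∑ j, ∑ m ∈ (P i j).support, ‖(P i j).coeff m‖) * ‖b.equivFun x‖ := by
          rw [← Finset.mul_sum, mul_comm]
      _ ≤ _ := by
          refine mul_le_mul_of_nonneg_right ?_ (norm_nonneg _)
          exact Finset.single_le_sum (f := fun i => ∑ j, ∑ m ∈ (P i j).support, ‖(P i j).coeff m‖)
            (fun _ _ => by positivity) (Finset.mem_univ i)
  have h3 : c * ‖ρ g x‖ ≤ K * (C * ‖x‖) :=
    (hb _).1.trans (h1.trans (mul_le_mul_of_nonneg_left (hb _).2 hK))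
  calc ‖ρ g x‖ ≤ c⁻¹ * (K * (C * ‖x‖)) := by rwa [le_inv_mul_iff₀ hc]
    _ = c⁻¹ * (K * C) * ‖x‖ := by ring
    _ ≤ _ := by gcongr; linarith

variable {U : Matrix (Fin n) (Fin n) ℂ} {l : Fin n → ℝ} {T : Subgroup G} {γ : ℂ → G}

/-- The weights on `ℂⁿ` of a torus containing `U diag(e^{z lᵢ}) U⁻¹` take there the values
`e^{z lᵢ}`. -/
theorem exists_charEval_eq_exp_of_mem_stdWeights (hU : Uᴴ * U = 1) (hγT : ∀ z, γ z ∈ T)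
    (hγ : ∀ z, toMat (γ z) = conjDiag U fun i => Complex.exp (z * l i)) {a : CharLattice T}
    (ha : a ∈ stdWeights T) : ∃ i, ∀ z, charEval a ⟨γ z, hγT z⟩ = Complex.exp (z * l i) := by
  obtain ⟨f, hf, -, ha⟩ := ha
  have h0 : Uᴴ * f a ≠ 0 := fun h => ha (by
    rw [← Matrix.one_mul (f a), ← mul_eq_one_comm.mp hU, Matrix.mul_assoc, h, Matrix.mul_zero])
  obtain ⟨i, j, hij⟩ : ∃ i j, (Uᴴ * f a) i j ≠ 0 := by
    by_contra! h
    exact h0 (Matrix.ext h)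
  refine ⟨i, fun z => ?_⟩
  have h1 : toMat (γ z) * f a = charEval a ⟨γ z, hγT z⟩ • f a := hf a ⟨γ z, hγT z⟩
  have h2 : diagonal (fun i => Complex.exp (z * l i)) * (Uᴴ * f a) =
      charEval a ⟨γ z, hγT z⟩ • (Uᴴ * f a) := by
    rw [← Matrix.mul_smul, ← h1, hγ, conjDiag]
    simp only [← Matrix.mul_assoc]
    rw [hU, Matrix.one_mul]
  have h3 := congrFun (congrFun h2 i) j
  rw [diagonal_mul, Matrix.smul_apply, smul_eq_mul] at h3
  exact (mul_right_cancel₀ hij h3).symm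

/-- The logarithm of the absolute value of characters at an element of the torus, as a linear
functional on `M_ℝ`. -/
noncomputable def logCharEval {T : Subgroup G} (t : T) : CharSpace T →ₗ[ℝ] ℝ :=
  LinearMap.liftBaseChange ℝ (AddMonoidHom.toIntLinearMap
    { toFun := fun a : CharLattice T => Real.log ‖charEval a t‖
      map_zero' := by simp [charEval_zero]
      map_add' := fun a b => by
        rw [charEval_add, norm_mul, Real.log_mul (norm_ne_zero_iff.mpr (charEval_ne_zero a t))
          (norm_ne_zero_iff.mpr (charEval_ne_zero b t))] })

theorem logCharEval_tmul {T : Subgroup G} (t : T) (a : CharLattice T) :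
    logCharEval t ((1 : ℝ) ⊗ₜ[ℤ] a) = Real.log ‖charEval a t‖ := by
  simp [logCharEval]

variable {V : Type*} [NormedAddCommGroup V] [NormedSpace ℂ V] [FiniteDimensional ℂ V]
  {ρ : Representation ℂ G V}

/-- A weight of `V` is a sum of standard weights, hence a real exponential along `γ`. The number of
summands is not controlled by the degree; the bound on `κ` comes from applying the functional `log
|·|` at `γ 1` to the inclusion of polytopes. -/
theorem exists_charEval_eq_exp_of_mem_weightSupport (hn : 0 < n) (hρ : IsRational ρ)
    (hU : Uᴴ * U = 1) (hT : IsMaximalTorus T) (hγT : ∀ z, γ z ∈ T)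
    (hγ : ∀ z, toMat (γ z) = conjDiag U fun i => Complex.exp (z * l i)) {L : ℝ}
    (hL : ∀ i, l i ≤ L) {v : V} (hv : v ≠ 0) {b : CharLattice T} (hb : b ∈ weightSupport ρ T v) :
    ∃ κ : ℝ, (∀ z, charEval b ⟨γ z, hγT z⟩ = Complex.exp (z * κ)) ∧ κ ≤ degree ρ * L := by
  obtain ⟨y, x, hyx⟩ := exists_eval_of_mem_weightSupport hb
  obtain ⟨P, hP⟩ := hρ.exists_polynomial y x
  obtain ⟨m, -, f, hf, hfb⟩ := exists_sum_stdWeights_of_eval hT.1 fun t => (hyx t).trans (hP t)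
  choose i hi using fun k => exists_charEval_eq_exp_of_mem_stdWeights hU hγT hγ (hf k)
  have hκ : ∀ z, charEval b ⟨γ z, hγT z⟩ = Complex.exp (z * (∑ k, l (i k) : ℝ)) := fun z => by
    rw [← hfb, charEval_sum, Complex.ofReal_sum, Finset.mul_sum, Complex.exp_sum]
    exact Finset.prod_congr rfl fun k _ => hi k z
  refine ⟨∑ k, l (i k), hκ, ?_⟩
  have hstd : stdPolytope T ⊆ {p | logCharEval ⟨γ 1, hγT 1⟩ p ≤ L} := by
    refine convexHull_min ?_ (convex_halfSpace_le (logCharEval _).isLinear L)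
    rintro _ ⟨a, ha, rfl⟩
    obtain ⟨i, hi⟩ := exists_charEval_eq_exp_of_mem_stdWeights hU hγT hγ ha
    rw [Set.mem_ofPred_eq, logCharEval_tmul, hi, Complex.norm_exp, Real.log_exp]
    simpa using hL i
  obtain ⟨p, hp, hpb⟩ := (degree_spec hn hρ).2 T hT v hv (subset_convexHull ℝ _ ⟨b, hb, rfl⟩)
  have h1 := congrArg (logCharEval ⟨γ 1, hγT 1⟩) hpb
  simp only [map_smul, smul_eq_mul] at h1
  rw [logCharEval_tmul, hκ, Complex.norm_exp, Real.log_exp] at h1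
  simp only [one_mul, Complex.ofReal_re] at h1
  rw [← h1]
  exact mul_le_mul_of_nonneg_left (hstd hp) (Nat.cast_nonneg _)

/-- Summing weight components would give a constant depending on the torus. Instead, `F z = e^{-z d}
ρ (γ z) v` with `d = degree ρ * L` is bounded on the right half-plane, and on the imaginary axis by
`M ‖v‖` since `γ` is unitary there. Phragmén–Lindelöf transports this bound to the positive real
axis. -/
theorem norm_apply_le_mul_exp (hn : 0 < n) (hρ : IsRational ρ) {M : ℝ}
    (hM : ∀ g : G, (toMat g)ᴴ * toMat g = 1 → ∀ x, ‖ρ g x‖ ≤ M * ‖x‖) (hU : Uᴴ * U = 1)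
    (hT : IsMaximalTorus T) (hγT : ∀ z, γ z ∈ T)
    (hγ : ∀ z, toMat (γ z) = conjDiag U fun i => Complex.exp (z * l i)) {L : ℝ}
    (hL : ∀ i, l i ≤ L) {v : V} (hv : v ≠ 0) {s : ℝ} (hs : 0 ≤ s) :
    ‖ρ (γ s) v‖ ≤ M * ‖v‖ * Real.exp (s * (degree ρ * L)) := by
  obtain ⟨f, hf, hfv⟩ := exists_weight_decomposition hρ hT.1 v
  have hκ : ∀ b : CharLattice T, ∃ κ : ℝ, f b ≠ 0 →
      (∀ z, charEval b ⟨γ z, hγT z⟩ = Complex.exp (z * κ)) ∧ κ ≤ degree ρ * L := by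
    intro b
    by_cases h : f b = 0
    · exact ⟨0, fun h' => (h' h).elim⟩
    · obtain ⟨κ, hκ⟩ := exists_charEval_eq_exp_of_mem_weightSupport hn hρ hU hT hγT hγ hL hv
        ⟨f, hf, hfv, h⟩
      exact ⟨κ, fun _ => hκ⟩
  choose κ hκ using hκ
  set d : ℝ := degree ρ * L
  let F : ℂ → V := fun z => Complex.exp (-(z * d)) • ρ (γ z) v
  have hF : F = fun z => ∑ b ∈ f.support, Complex.exp (z * (κ b - d)) • f b := by
    ext z
    simp only [F]
    conv_lhs => rw [← hfv, Finsupp.sum, map_sum, Finset.smul_sum]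
    refine Finset.sum_congr rfl fun b hb => ?_
    rw [hf b ⟨γ z, hγT z⟩, (hκ b (Finsupp.mem_support_iff.mp hb)).1, smul_smul, ← Complex.exp_add]
    congr 2
    ring
  have hdiff : Differentiable ℂ F := by rw [hF]; fun_prop
  have hbound : ∀ z : ℂ, 0 ≤ z.re → ‖F z‖ ≤ ∑ b ∈ f.support, ‖f b‖ := by
    intro z hz
    rw [hF]
    refine norm_sum_le_of_le _ fun b hb => ?_
    rw [norm_smul, Complex.norm_exp]
    refine mul_le_of_le_one_left (norm_nonneg _) (Real.exp_le_one_iff.mpr ?_)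
    rw [← Complex.ofReal_sub, Complex.re_mul_ofReal]
    exact mul_nonpos_of_nonneg_of_nonpos hz
      (sub_nonpos.mpr (hκ b (Finsupp.mem_support_iff.mp hb)).2)
  have him : ∀ x : ℝ, ‖F (x * Complex.I)‖ ≤ M * ‖v‖ := by
    intro x
    have h1 : ‖Complex.exp (-(x * Complex.I * d))‖ = 1 := by
      rw [Complex.norm_exp]; simp
    rw [norm_smul, h1, one_mul]
    refine hM _ ?_ v
    have h2 : (toMat (γ (x * Complex.I)))ᴴ =
        conjDiag U fun i => Complex.exp (-(x * Complex.I * l i)) := by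
      rw [hγ, conjDiag, conjDiag, conjTranspose_mul, conjTranspose_mul, conjTranspose_conjTranspose,
        diagonal_conjTranspose, Matrix.mul_assoc]
      congr 3
      ext i
      simp [← Complex.exp_conj]
    rw [h2, hγ, conjDiag_mul hU, ← conjDiag_one hU]
    congr 1
    ext i
    simp [← Complex.exp_add]
  -- The growth condition holds with order `1 < 2` and exponent constant `0`, as `F` is bounded.
  have key := PhragmenLindelof.right_half_plane_of_bounded_on_real (z := (s : ℂ))
    hdiff.diffContOnCl ⟨1, one_lt_two, 0, ?_⟩ ?_ him (by simpa using hs)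
  · have h3 : ρ (γ s) v = Complex.exp (s * d) • F s := by
      rw [smul_smul, ← Complex.exp_add]; simp
    rw [h3, norm_smul, mul_comm]
    refine mul_le_mul key (le_of_eq ?_) (norm_nonneg _) ((norm_nonneg _).trans key)
    rw [Complex.norm_exp, Complex.re_mul_ofReal, Complex.ofReal_re]
  · refine Asymptotics.IsBigO.of_bound (∑ b ∈ f.support, ‖f b‖) ?_
    refine Filter.mem_inf_of_right fun z hz => ?_
    simpa using hbound z (le_of_lt hz)
  · refine Filter.isBoundedUnder_of_eventually_le (a := ∑ b ∈ f.support, ‖f b‖) ?_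
    filter_upwards [Filter.eventually_ge_atTop 0] with x hx
    exact hbound x (by simpa using hx)

end Growth

/-! ### The lower bound of the Aubin functional -/

section Aubin

open Matrix
open scoped ComplexOrder

theorem trace_conjTranspose_mul_self_toMat (g : G) :
    ((toMat g)ᴴ * toMat g).trace = (matNormSq g : ℂ) := by
  simp only [trace, diag_apply, mul_apply, conjTranspose_apply, matNormSq]
  rw [Finset.sum_comm]
  push_cast
  refine Finset.sum_congr rfl fun i _ => Finset.sum_congr rfl fun j _ => ?_
  rw [← Complex.conj_mul']
  rfl

theorem posDef_conjTranspose_mul_self_toMat (g : G) : ((toMat g)ᴴ * toMat g).PosDef :=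
  PosDef.conjTranspose_mul_self _ (mulVec_injective_of_isUnit
    ((isUnit_iff_isUnit_det _).mpr (by rw [det_toMat]; exact isUnit_one)))

/-- Polar decomposition in an algebraic group stable under conjugate transposition, with a torus
containing the complex powers of the positive definite factor. -/
theorem exists_polar_decomposition (hG : IsAlgebraicGroup G)
    (hstar : ∀ g : G, ∃ g' : G, toMat g' = (toMat g)ᴴ) (g : G) :
    ∃ (U : Matrix (Fin n) (Fin n) ℂ) (l : Fin n → ℝ) (T : Subgroup G) (γ : ℂ → G) (k : G),
      Uᴴ * U = 1 ∧ (∀ i, l i ≤ Real.log (matNormSq g)) ∧ IsMaximalTorus T ∧ (∀ z, γ z ∈ T) ∧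
      (∀ z, toMat (γ z) = conjDiag U fun i => Complex.exp (z * l i)) ∧
      (toMat k)ᴴ * toMat k = 1 ∧ g = k * γ ((1 / 2 : ℝ) : ℂ) := by
  have hpos := posDef_conjTranspose_mul_self_toMat g
  let x := hpos.1.eigenvalues
  let U : Matrix (Fin n) (Fin n) ℂ := hpos.1.eigenvectorUnitary
  have hx : ∀ i, 0 < x i := hpos.eigenvalues_pos
  have hU : Uᴴ * U = 1 := mem_unitaryGroup_iff'.mp hpos.1.eigenvectorUnitary.2
  have hh : (toMat g)ᴴ * toMat g = conjDiag U fun i => (x i : ℂ) := by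
    conv_lhs => rw [hpos.1.spectral_theorem]
    rfl
  obtain ⟨g', hg'⟩ := hstar g
  have hexp : ∀ i, Real.exp (Real.log (x i)) = x i := fun i => Real.exp_log (hx i)
  -- The group is stable under conjugate transposition, so it contains `gᴴ g` and its powers; `γ
  -- (1/2)` is then the positive square root.
  obtain ⟨S, hS, γ, hγS, hγ⟩ := exists_isTorus_of_pow_mem hG hU (fun i => Real.log (x i)) fun k => by
    refine ⟨(g' * g) ^ k, ?_⟩
    have hpow : toMat ((g' * g) ^ k) = (toMat (g' * g)) ^ k := by simp [toMat]
    rw [hpow, toMat_mul, hg', hh, conjDiag_pow hU]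
    simp only [hexp]
    rfl
  obtain ⟨T, hST, hT⟩ := hS.exists_le_isMaximalTorus
  set p := γ ((1 / 2 : ℝ) : ℂ) with hp
  have hpp : toMat p * toMat p = (toMat g)ᴴ * toMat g := by
    rw [hh, hp, hγ, conjDiag_mul hU]
    congr 1
    ext i
    rw [Pi.mul_apply, ← Complex.exp_add, ← add_mul, ← Complex.ofReal_add, add_halves,
      Complex.ofReal_one, one_mul, ← Complex.ofReal_exp, hexp]
  have hpherm : (toMat p)ᴴ = toMat p := by
    rw [hp, hγ, conjDiag, conjTranspose_mul, conjTranspose_mul, conjTranspose_conjTranspose,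
      diagonal_conjTranspose, Matrix.mul_assoc]
    congr 3
    ext i
    rw [Pi.star_apply, ← Complex.ofReal_mul, ← Complex.ofReal_exp]
    exact Complex.conj_ofReal _
  have hinv : toMat p * toMat p⁻¹ = 1 := by rw [← toMat_mul, mul_inv_cancel, toMat_one]
  -- Each eigenvalue of `gᴴ g` is at most the trace, which is `matNormSq g`.
  refine ⟨U, _, T, γ, g * p⁻¹, hU, fun i => Real.log_le_log (hx i) ?_, hT, fun z => hST (hγS z), hγ,
    ?_, (inv_mul_cancel_right g p).symm⟩
  · have h1 := hpos.1.trace_eq_sum_eigenvalues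
    rw [trace_conjTranspose_mul_self_toMat] at h1
    have h2 : matNormSq g = ∑ i, hpos.1.eigenvalues i :=
      Complex.ofReal_injective (by rw [h1, Complex.ofReal_sum]; rfl)
    rw [h2]
    exact Finset.single_le_sum (fun j _ => (hx j).le) (Finset.mem_univ i)
  · calc (toMat (g * p⁻¹))ᴴ * toMat (g * p⁻¹)
        = (toMat p⁻¹)ᴴ * ((toMat g)ᴴ * toMat g) * toMat p⁻¹ := by
          rw [toMat_mul, conjTranspose_mul]; simp only [Matrix.mul_assoc]
      _ = (toMat p * toMat p⁻¹)ᴴ * (toMat p * toMat p⁻¹) := by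
          rw [← hpp, conjTranspose_mul, hpherm]; simp only [Matrix.mul_assoc]
      _ = 1 := by rw [hinv, conjTranspose_one, Matrix.one_mul]

/-- In `g = k γ(1/2)` one factor `M` accounts for the unitary `k` and another for the growth along
`γ`. At time `1/2`, with rates at most `log ‖g‖²`, that growth is at most `‖g‖^q`, independently of
the torus. -/
theorem bddBelow_range_aubin {V : Type*} [NormedAddCommGroup V] [InnerProductSpace ℂ V]
    [FiniteDimensional ℂ V] {ρ : Representation ℂ G V} (hn : 0 < n) (hG : IsAlgebraicGroup G)
    (hstar : ∀ g : G, ∃ g' : G, toMat g' = (toMat g)ᴴ) (hρ : IsRational ρ) {v : V} (hv : v ≠ 0) :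
    BddBelow (Set.range (aubin ρ v)) := by
  obtain ⟨M, hM0, hM⟩ := exists_norm_apply_le_of_unitary hρ
  refine ⟨-(degree ρ * Real.log n) - Real.log ((M * M) ^ 2), ?_⟩
  rintro _ ⟨g, rfl⟩
  obtain ⟨U, l, T, γ, k, hU, hl, hT, hγT, hγ, hk, hgk⟩ := exists_polar_decomposition hG hstar g
  have hS := matNormSq_pos hn g
  have hn' : (0 : ℝ) < n := by exact_mod_cast hn
  have hv' : 0 < ‖v‖ := norm_pos_iff.mpr hv
  have h1 : ‖ρ g v‖ ≤ M * M * Real.exp (1 / 2 * (degree ρ * Real.log (matNormSq g))) * ‖v‖ := by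
    calc ‖ρ g v‖ = ‖ρ k (ρ (γ ((1 / 2 : ℝ) : ℂ)) v)‖ := by
          conv_lhs => rw [hgk, map_mul, Module.End.mul_apply]
      _ ≤ M * ‖ρ (γ ((1 / 2 : ℝ) : ℂ)) v‖ := hM k hk _
      _ ≤ M * (M * ‖v‖ * Real.exp (1 / 2 * (degree ρ * Real.log (matNormSq g)))) :=
          mul_le_mul_of_nonneg_left (norm_apply_le_mul_exp hn hρ hM hU hT hγT hγ hl hv (by norm_num))
            hM0.le
      _ = _ := by ring
  have hρv : 0 < ‖ρ g v‖ := norm_pos_iff.mpr (representation_apply_ne_zero ρ hv g)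
  have h2 : Real.log (‖ρ g v‖ ^ 2 / ‖v‖ ^ 2) ≤
      Real.log ((M * M) ^ 2) + degree ρ * Real.log (matNormSq g) := by
    rw [← div_pow]
    calc Real.log ((‖ρ g v‖ / ‖v‖) ^ 2)
        ≤ Real.log ((M * M * Real.exp (1 / 2 * (degree ρ * Real.log (matNormSq g)))) ^ 2) := by
          gcongr
          rwa [div_le_iff₀ hv']
      _ = _ := by
          rw [mul_pow, Real.log_mul (by positivity) (by positivity), ← Real.exp_nat_mul,
            Real.log_exp]
          push_cast
          ring
  rw [aubin, Real.log_div hS.ne' hn'.ne']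
  linarith

end Aubin

/-! ### The classical groups -/

section Classical

open Matrix

/-- Adding `det - 1` to the equations cuts `G` out of the space of all matrices, not only of `SL`.
-/
theorem isAlgebraicGroup_of_mem_iff {κ : Type*} (Φ : κ → MvPolynomial (Fin n × Fin n) ℂ)
    (h : ∀ A : Matrix.SpecialLinearGroup (Fin n) ℂ, A ∈ G ↔ ∀ k,
      MvPolynomial.eval (entries (A : Matrix (Fin n) (Fin n) ℂ)) (Φ k) = 0) :
    IsAlgebraicGroup G := by
  refine ⟨insert ((mvPolynomialX (Fin n) (Fin n) ℂ).det - 1) (Set.range Φ), fun A => ?_⟩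
  have hdet : MvPolynomial.eval (entries A) (mvPolynomialX (Fin n) (Fin n) ℂ).det = A.det := by
    rw [RingHom.map_det]
    congr 1
    ext i j
    simp [mvPolynomialX, entries]
  rw [Set.forall_mem_insert, Set.forall_mem_range, map_sub, hdet, map_one, sub_eq_zero]
  constructor
  · rintro ⟨g, rfl⟩
    exact ⟨det_toMat g, (h g).mp g.2⟩
  · rintro ⟨h1, h2⟩
    exact ⟨⟨⟨A, h1⟩, (h ⟨A, h1⟩).mpr h2⟩, rfl⟩

theorem isAlgebraicGroup_of_mem_iff_matrix {κ : Type*}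
    (Φ : Matrix κ κ (MvPolynomial (Fin n × Fin n) ℂ))
    (h : ∀ A : Matrix.SpecialLinearGroup (Fin n) ℂ, A ∈ G ↔
      Φ.map (MvPolynomial.eval (entries (A : Matrix (Fin n) (Fin n) ℂ))) = 0) :
    IsAlgebraicGroup G :=
  isAlgebraicGroup_of_mem_iff (fun ij : κ × κ => Φ ij.1 ij.2) fun A => by
    rw [h, ← Matrix.ext_iff]
    simp

theorem map_eval_mvPolynomialX (A : Matrix (Fin n) (Fin n) ℂ) :
    (mvPolynomialX (Fin n) (Fin n) ℂ).map (MvPolynomial.eval (entries A)) = A := by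
  ext i j
  simp [mvPolynomialX, entries]

theorem IsClassicalGroup.isAlgebraicGroup (hG : IsClassicalGroup G) : IsAlgebraicGroup G := by
  cases hG with
  | specialLinear h => exact isAlgebraicGroup_of_mem_iff Empty.elim fun A => by simp [h]
  | specialOrthogonal h =>
    refine isAlgebraicGroup_of_mem_iff_matrix
      ((mvPolynomialX (Fin n) (Fin n) ℂ)ᵀ * mvPolynomialX (Fin n) (Fin n) ℂ - 1) fun A => ?_
    rw [h, Matrix.map_sub _ (map_sub _), Matrix.map_mul, transpose_map, map_eval_mvPolynomialX,
      Matrix.map_one _ (map_zero _) (map_one _), sub_eq_zero]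
  | symplectic N e h =>
    refine isAlgebraicGroup_of_mem_iff_matrix
      (reindex e e (mvPolynomialX (Fin n) (Fin n) ℂ) * J (Fin N) _ *
        (reindex e e (mvPolynomialX (Fin n) (Fin n) ℂ))ᵀ - J (Fin N) _) fun A => ?_
    have h1 : (reindex e e (mvPolynomialX (Fin n) (Fin n) ℂ)).map
        (MvPolynomial.eval (entries (A : Matrix (Fin n) (Fin n) ℂ))) =
        reindex e e (A : Matrix (Fin n) (Fin n) ℂ) := by
      conv_rhs => rw [← map_eval_mvPolynomialX (A : Matrix (Fin n) (Fin n) ℂ)]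
      rfl
    rw [h, SymplecticGroup.mem_iff, Matrix.map_sub _ (map_sub _), Matrix.map_mul, Matrix.map_mul,
      transpose_map, h1, map_J, sub_eq_zero]

/-- The defining forms are real and the groups are stable under transposition and entrywise
conjugation. This is what keeps the polar decomposition inside `G`. -/
theorem IsClassicalGroup.exists_toMat_eq_conjTranspose (hG : IsClassicalGroup G) (g : G) :
    ∃ g' : G, toMat g' = (toMat g)ᴴ := by
  have hdet : ((toMat g)ᴴ).det = 1 := by rw [det_conjTranspose, det_toMat, star_one]
  suffices h0 : (⟨_, hdet⟩ : Matrix.SpecialLinearGroup (Fin n) ℂ) ∈ G from ⟨⟨_, h0⟩, rfl⟩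
  cases hG with
  | specialLinear h => exact h _
  | specialOrthogonal h =>
    refine (h _).mpr ?_
    have h1 : (toMat g)ᵀ * toMat g = 1 := (h g).mp g.2
    change (toMat g)ᴴᵀ * (toMat g)ᴴ = 1
    have h2 := congrArg conjTranspose (mul_eq_one_comm.mp h1)
    rwa [conjTranspose_mul, conjTranspose_one] at h2
  | symplectic N e h =>
    refine (h _).mpr ?_
    have h1 : reindex e e (toMat g) ∈ symplecticGroup (Fin N) ℂ := (h g).mp g.2
    have h2 := SymplecticGroup.map_mem (SymplecticGroup.transpose_mem h1) (starRingEnd ℂ)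
    exact h2

end Classical
end StablePairs

theorem mainTheorem4 {n : ℕ} (hn : 0 < n) (G : Subgroup (Matrix.SpecialLinearGroup (Fin n) ℂ))
    (hG : StablePairs.IsClassicalGroup G)
    {V W : Type*}
    [NormedAddCommGroup V] [InnerProductSpace ℂ V] [FiniteDimensional ℂ V]
    [NormedAddCommGroup W] [InnerProductSpace ℂ W] [FiniteDimensional ℂ W]
    (ρ : Representation ℂ G V) (σ : Representation ℂ G W)
    (hρ : StablePairs.IsRational ρ) (hσ : StablePairs.IsRational σ)
    (v : V) (w : W) (hv : v ≠ 0) (hw : w ≠ 0) :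
    (StablePairs.Semistable ρ σ v w ↔ BddBelow (Set.range (StablePairs.mabuchi ρ σ v w))) ∧
    (StablePairs.Stable ρ σ v w ↔ StablePairs.MabuchiProper ρ σ v w) ∧
    (⨅ g : G, ((StablePairs.mabuchi ρ σ v w g : ℝ) : EReal)) =
      ENNReal.log (ENNReal.ofReal (Real.tan (StablePairs.orbitDist ρ σ v w) ^ 2)) +
        ((Real.log (‖v‖ ^ 2 / ‖w‖ ^ 2) : ℝ) : EReal) := by
  have hA := hG.isAlgebraicGroup
  exact ⟨StablePairs.semistable_iff_bddBelow hA hρ hσ hv hw,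
    StablePairs.stable_iff_mabuchiProper hn hA hρ hσ hv hw
      (StablePairs.bddBelow_range_aubin hn hA hG.exists_toMat_eq_conjTranspose hρ hv),
    StablePairs.iInf_mabuchi_eq hA hρ hσ hv hw⟩
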